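/- **Setting.** Consider a Markov decision process with measurable observation space $\mathcal X$, nonempty measurable action space $\mathcal A$ (with measurable singletons), horizon $H\ge 1$, transition kernels $P_h$, conditional cost distributions $C_h$ on $[0,1]$ ($h\in[H]$), and a fixed initial state $x_1$. A policy is a tuple of kernels $\pi_h:\mathcal X\to\Delta(\mathcal A)$; $V^\pi=\mathbb E_\pi[\sum_{h=1}^H c_h]$ is its value, and $V^\star=\inf_\pi V^\pi$. Let $\mathcal F=\mathcal F_1\times\dots\times\mathcal F_H$, where each $\mathcal F_h$ is a finite set of measurable functions $f_h:\mathcal X\times\mathcal A\to[0,1]$ such that $x\mapsto\min_a f_h(x,a)$ is measurable (automatic if $\mathcal A$ is finite), with the convention $f_{H+1}=0$, $\mathcal F_{H+1}=\{0\}$; for infinite $\mathcal A$, $\min_a$ denotes the infimum. Let $\mathcal T^\star_h g(x,a)=\mathbb E_{c\sim C_h(x,a),\,x'\sim P_h(x,a)}[c+\min_{a'}g(x',a')]$, and assume $\mathcal T^\star$-Bellman completeness: $\mathcal T^\star_h g\in\mathcal F_h$ for all $h\in[H]$ and $g\in\mathcal F_{h+1}$. **Algorithm.** In each round $k=1,\dots,K$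 ($K\ge1$), given the previously collected transitions $(x_{h,i},a_{h,i},c_{h,i},x'_{h,i})_{h\in[H],\,i<k}$, put $$L_h(g,g')=\sum_{i<k}\Bigl(g(x_{h,i},a_{h,i})-c_{h,i}-\min_{a'}g'(x'_{h,i},a')\Bigr)^2,$$ $$\mathcal F_k=\Bigl\{f\in\mathcal F:\ \forall h\in[H],\ L_h(f_h,f_{h+1})-\min_{g\in\mathcal F_h}L_h(g,f_{h+1})\le\beta\Bigr\}.$$ Choose $f^k\in\arg\min_{f\in\mathcal F_k}\min_a f_1(x_1,a)$ and let $\pi^k$ be greedy with respect to $f^k$, i.e. $\pi^k_h(x)$ is supported on $\arg\min_a f^k_h(x,a)$ (ties are broken in any measurable, possibly history-dependent and randomized way). If uniform exploration (UA) is off, roll in $\pi^k$ once and record the transition of each step $h$. If UA is on (then $A=|\mathcal A|<\infty$), for every $h$ independently roll in $\pi^k$ up to $x_h$, draw $a_h\sim\mathrm{Unif}(\mathcal A)$, and record $(x_h,a_h,c_h,x'_h)$. **Eluder dimension.** For a set $\Psi$ of functions $\mathcal S\to\mathbb R$, a set $\mathcal M$ of distributions on $\mathcal S$ and $\varepsilon_0>0$,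 let $\mathrm{EluDim}_2(\Psi,\mathcal M,\varepsilon_0)\in\mathbb N\cup\{\infty\}$ be the supremum of the lengths $L$ of sequences $\mu^{(1)},\dots,\mu^{(L)}\in\mathcal M$ for which there is $\varepsilon\ge\varepsilon_0$ such that for every $t\in[L]$ some $\psi\in\Psi$ has $|\mathbb E_{\mu^{(t)}}\psi|>\varepsilon$ and $\sum_{i<t}|\mathbb E_{\mu^{(i)}}\psi|^2\le\varepsilon^2$. Let $\mathcal E_h(x,a;f)=(f_h(x,a)-\mathcal T^\star_hf_{h+1}(x,a))^2$, and let $d_h^\pi$ denote the state-action visitation distribution of $\pi$ at step $h$ and, in $d^{\mathrm V}_{\mathrm{sq}}$, the state visitation distribution. Put $$d_{\mathrm{sq}}=\max_h\mathrm{EluDim}_2\bigl(\{\mathcal E_h(\cdot;f):f\in\mathcal F\},\{d_h^\pi:\pi\text{ a policy}\},1/K\bigr),$$ $$d^{\mathrm V}_{\mathrm{sq}}=\max_h\mathrm{EluDim}_2\bigl(\{x\mapsto\mathbb E_{a\sim\mathrm{Unif}(\mathcal A)}\mathcal E_h(x,a;f):f\in\mathcal F\},\{d_h^\pi(x):\pi\text{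 a policy}\},1/K\bigr).$$ **Theorem.** There is a universal constant $c>0$ such that in every such setting, for every $\delta\in(0,1)$ and with $\beta=2\ln(H|\mathcal F|/\delta)$, with probability at least $1-\delta$, $$\sum_{k=1}^K\bigl(V^{\pi^k}-V^\star\bigr)\le c\,H\sqrt{K\,d\,\beta\,(1+\ln K)},$$ where $d=\max\{1,d_{\mathrm{sq}}\}$ if UA is off and $d=A\max\{1,d^{\mathrm V}_{\mathrm{sq}}\}$ if UA is on. (If $d=\infty$ the claim is void.) -/

import Mathlib

open MeasureTheory ProbabilityTheory

namespace OnlineRL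

/-- One observed transition `((x, a), (c, x'))`. -/
abbrev Transition (X A : Type*) := (X × A) × (ℝ × X)

/-- The data gathered in one round: one transition for every step `h`. -/
abbrev RoundData (X A : Type*) (H : ℕ) := Fin H → Transition X A

/-- The data gathered in the first `k` rounds. -/
abbrev History (X A : Type*) (H k : ℕ) := Fin k → RoundData X A H

/-- A finite-horizon Markov decision process with costs in `[0, 1]` and a fixed initial state.
Steps are indexed by `0, …, H - 1`. -/
structure MDP (X A : Type*) [MeasurableSpace X] [MeasurableSpace A] (H : ℕ) where
  /-- transition kernels -/
  P : Fin H → Kernel (X × A) X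
  /-- conditional cost distributions -/
  C : Fin H → Kernel (X × A) ℝ
  /-- initial state -/
  init : X
  markov_P : ∀ h, IsMarkovKernel (P h)
  markov_C : ∀ h, IsMarkovKernel (C h)
  cost_mem : ∀ h p, ∀ᵐ c ∂(C h p), c ∈ Set.Icc (0 : ℝ) 1

attribute [instance] MDP.markov_P MDP.markov_C

/-- A (Markov, randomized) policy. -/
structure Policy (X A : Type*) [MeasurableSpace X] [MeasurableSpace A] (H : ℕ) where
  act : Fin H → Kernel X A
  markov : ∀ h, IsMarkovKernel (act h)

attribute [instance] Policy.markov

noncomputable section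

variable {X A : Type*} [MeasurableSpace X] [MeasurableSpace A] {H : ℕ}

/-- From state `x`: draw `a ∼ π(x)`, then `c ∼ C(x, a)` and `x' ∼ P(x, a)`, and record
`((x, a), (c, x'))`. -/
def stepKernel (π : Kernel X A) (C : Kernel (X × A) ℝ) (P : Kernel (X × A) X) :
    Kernel X (Transition X A) :=
  (Kernel.id ×ₖ π) ⊗ₖ Kernel.prodMkLeft X (C ×ₖ P)

/-- The law of the trajectory of length `n`, given its first state: take one step, then continue
from the state that was reached. -/
def trajKernel : (n : ℕ) → (Fin n → Kernel X A) → (Fin n → Kernel (X × A) ℝ) →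
    (Fin n → Kernel (X × A) X) → Kernel X (Fin n → Transition X A)
  | 0, _, _, _ => Kernel.const X (Measure.dirac Fin.elim0)
  | n + 1, π, C, P =>
    (stepKernel (π 0) (C 0) (P 0) ⊗ₖ
      (trajKernel n (fun i => π i.succ) (fun i => C i.succ) (fun i => P i.succ)).comap
        (fun p : X × Transition X A => p.2.2.2) (by fun_prop)).map
      (fun q => (Fin.cons q.1 q.2 : Fin (n + 1) → Transition X A))

/-- The law of the trajectory obtained by rolling in `π` from the initial state. -/
def rollIn (M : MDP X A H) (π : Fin H → Kernel X A) : Measure (RoundData X A H) :=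
  trajKernel H π M.C M.P M.init

/-- The value `V^π`: expected cumulative cost of rolling in `π`. -/
def value (M : MDP X A H) (π : Policy X A H) : ℝ :=
  ∫ τ, ∑ h, (τ h).2.1 ∂(rollIn M π.act)

/-- The optimal value `V^⋆`. -/
def optValue (M : MDP X A H) : ℝ := ⨅ π : Policy X A H, value M π

/-- State-action visitation distribution of `π` at step `h`. -/
def visit (M : MDP X A H) (π : Policy X A H) (h : Fin H) : Measure (X × A) :=
  (rollIn M π.act).map (fun τ => (τ h).1)

/-- State visitation distribution of `π` at step `h`. -/
def stateVisit (M : MDP X A H) (π : Policy X A H) (h : Fin H) : Measure X :=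
  (rollIn M π.act).map (fun τ => (τ h).1.1)

/-- The kernel that plays a uniformly random action (for a finite action space). -/
def uniformAct (X A : Type*) [MeasurableSpace X] [MeasurableSpace A] : Kernel X A :=
  Kernel.const X (uniformOn (Set.univ : Set A))

/-- The law of the data gathered in one round with policy `π`. Without uniform exploration, this
is one trajectory of `π`. With uniform exploration, there are `H` independent roll-ins; the one
for step `h` follows `π` before step `h`, plays a uniform action at step `h`, and the transition
at step `h` is kept. -/
def gather (M : MDP X A H) (ua : Bool) (π : Policy X A H) : Measure (RoundData X A H) :=
  if ua then
    Measure.pi fun h =>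
      (rollIn M (Function.update π.act h (uniformAct X A))).map (fun τ => τ h)
  else rollIn M π.act

/-- `min_a g(x, a)`. -/
def minAct (g : X × A → ℝ) (x : X) : ℝ := ⨅ a, g (x, a)

/-- The Bellman optimality operator `T⋆_h`. -/
def bellman (M : MDP X A H) (h : Fin H) (g : X × A → ℝ) (p : X × A) : ℝ :=
  ∫ y : ℝ × X, (y.1 + minAct g y.2) ∂((M.C h ×ₖ M.P h) p)

/-- `f_{h+1}`, with the convention that it is zero after the last step. -/
def next (f : Fin H → X × A → ℝ) (h : Fin H) : X × A → ℝ :=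
  if hh : (h : ℕ) + 1 < H then f ⟨h + 1, hh⟩ else 0

/-- The tuples `f = (f_1, …, f_H)` in the class `F_1 × ⋯ × F_H`. -/
def tuples (F : Fin H → Finset (X × A → ℝ)) : Set (Fin H → X × A → ℝ) :=
  {f | ∀ h, f h ∈ F h}

/-- The class `F_{h+1}`, which is `{0}` after the last step. -/
def nextClass (F : Fin H → Finset (X × A → ℝ)) (h : Fin H) : Set (X × A → ℝ) :=
  if hh : (h : ℕ) + 1 < H then (F ⟨h + 1, hh⟩ : Set (X × A → ℝ)) else {0}

/-- Bellman completeness with respect to `T⋆`. -/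
def BellmanComplete (M : MDP X A H) (F : Fin H → Finset (X × A → ℝ)) : Prop :=
  ∀ h, ∀ g ∈ nextClass F h, bellman M h g ∈ F h

/-- The empirical squared TD loss `L_h(g, g', D_h)`. -/
def tdLoss {k : ℕ} (D : History X A H k) (h : Fin H) (g g' : X × A → ℝ) : ℝ :=
  ∑ i, (g (D i h).1 - ((D i h).2.1 + minAct g' (D i h).2.2)) ^ 2

/-- The version space with threshold `β`. -/
def versionSpace (F : Fin H → Finset (X × A → ℝ)) (β : ℝ) {k : ℕ} (D : History X A H k) :
    Set (Fin H → X × A → ℝ) :=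
  {f | f ∈ tuples F ∧ ∀ h,
    tdLoss D h (f h) (next f h) - (⨅ g : F h, tdLoss D h g (next f h)) ≤ β}

/-- The policy that a history-dependent decision rule plays after the history `D`. -/
def policyAt {k : ℕ} (κ : Fin H → Kernel (History X A H k × X) A) [∀ h, IsMarkovKernel (κ h)]
    (D : History X A H k) : Policy X A H :=
  ⟨fun h => (κ h).sectR D, fun _ => inferInstance⟩

/-- `f` and `π` are the choices of the optimistic algorithm in rounds `0, …, K - 1`, as functions
of the data gathered so far: `f k D` minimizes `min_a f_1(x_1, a)` over the version space and
`π k` plays greedily with respect to it. All ways of breaking ties are allowed. -/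
structure IsOptimistic [NeZero H] (M : MDP X A H) (F : Fin H → Finset (X × A → ℝ)) (β : ℝ)
    (K : ℕ) (f : (k : ℕ) → History X A H k → Fin H → X × A → ℝ)
    (π : (k : ℕ) → Fin H → Kernel (History X A H k × X) A) : Prop where
  mem : ∀ k < K, ∀ D, f k D ∈ versionSpace F β D
  optimistic : ∀ k < K, ∀ D, ∀ g ∈ versionSpace F β D,
    minAct (f k D 0) M.init ≤ minAct (g 0) M.init
  greedy : ∀ k < K, ∀ D h x, ∀ᵐ a ∂(π k h (D, x)), ∀ a', f k D h (x, a) ≤ f k D h (x, a')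

/-- The law of the data of the first `k` rounds when the policies are chosen by `π`. -/
def historyLaw (M : MDP X A H) (ua : Bool)
    (π : (k : ℕ) → Fin H → Kernel (History X A H k × X) A) [∀ k h, IsMarkovKernel (π k h)] :
    (k : ℕ) → Measure (History X A H k)
  | 0 => Measure.dirac Fin.elim0
  | k + 1 => (historyLaw M ua π k).bind fun D =>
      (gather M ua (policyAt (π k) D)).map
        (fun d => (Fin.snoc D d : Fin (k + 1) → RoundData X A H))

/-- The data of the rounds before round `k`. -/
def past {K : ℕ} (D : History X A H K) (k : Fin K) : History X A H k :=
  fun i => D (Fin.castLE k.2.le i)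

/-- `∑_{k < K} (V^{π^k} - V^⋆)` when the gathered data are `D`. -/
def regret (M : MDP X A H) (π : (k : ℕ) → Fin H → Kernel (History X A H k × X) A)
    [∀ k h, IsMarkovKernel (π k h)] {K : ℕ} (D : History X A H K) : ℝ :=
  ∑ k : Fin K, (value M (policyAt (π k) (past D k)) - optValue M)

/-- The `ℓ_q`-eluder dimension: the supremum of the lengths of the sequences in `𝓜` for which,
for some `ε ≥ ε₀`, every entry is `ε`-independent of its predecessors. -/
def eluderDim {S : Type*} [MeasurableSpace S] (q : ℕ) (Ψ : Set (S → ℝ)) (𝓜 : Set (Measure S))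
    (ε₀ : ℝ) : ℕ∞ :=
  ⨆ (L : ℕ) (_ : ∃ μ : Fin L → Measure S, (∀ t, μ t ∈ 𝓜) ∧ ∃ ε ≥ ε₀, ∀ t, ∃ ψ ∈ Ψ,
    ε < |∫ s, ψ s ∂(μ t)| ∧ ∑ i ∈ Finset.Iio t, |∫ s, ψ s ∂(μ i)| ^ q ≤ ε ^ q), (L : ℕ∞)

/-- The squared Bellman error of `f` at step `h`. -/
def sqError (M : MDP X A H) (h : Fin H) (f : Fin H → X × A → ℝ) (p : X × A) : ℝ :=
  (f h p - bellman M h (next f h) p) ^ 2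

/-- The eluder dimension `d_sq`. -/
def dSq (M : MDP X A H) (F : Fin H → Finset (X × A → ℝ)) (K : ℕ) : ℕ∞ :=
  ⨆ h, eluderDim 2 (sqError M h '' tuples F) (Set.range fun π => visit M π h) (1 / K)

/-- The V-type eluder dimension `d_sq^V`. -/
def dSqV (M : MDP X A H) (F : Fin H → Finset (X × A → ℝ)) (K : ℕ) : ℕ∞ :=
  ⨆ h, eluderDim 2
    ((fun f x => ∫ a, sqError M h f (x, a) ∂(uniformOn (Set.univ : Set A))) '' tuples F)
    (Set.range fun π => stateVisit M π h) (1 / K)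

end

end OnlineRL

open OnlineRL

open scoped ENNReal

namespace OnlineRL

/-! ### Laws of trajectories, by recursion on their length. -/

section Trajectory

variable {X A Z : Type*} [MeasurableSpace X] [MeasurableSpace A] [MeasurableSpace Z]

/-! The argument is optimism plus a pigeonhole form of the eluder bound. Completeness yields, by
backward recursion, a tuple `q` in the class solving the Bellman equations, and `minAct (q 0)
M.init` is at most every policy value. As long as `q` stays in the version space, the prediction of
the chosen `f` is therefore at most `optValue M`. The regret of a round is then at most the value of
the greedy policy minus the prediction of `f`, which telescopes into expected Bellman errors under
that policy and is bounded by square roots of expected squared errors (`value_sub_minAct_le`).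

Write Δ for the Bellman error of `g` against the backup of `g'`. The excess TD loss of one
transition is Δ² minus 2Δ times a centred variable with values in an interval of length 2. By
Hoeffding's lemma, the exponential of `-r` times the excess has conditional mean at most exp((2r² -
r)Δ²). With r = 1/2 this is a supermartingale, which keeps `q` in the version space; with r = 1/4
there is a surplus, which bounds the past population errors of every surviving `f` by 20β. Ville's
inequality makes both uniform in time, and a union bound over the finite class finishes
(`historyLaw_good`).

It remains to pass from past errors to current ones. If the past errors of each round sum to at most
R, the rounds with current error above ε can be split into about R/ε buckets, inside each of which
the past errors sum to at most ε. Hence each bucket is an eluder sequence and there are at most (R/ε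
+ 1)d such rounds. Summing over the levels ε = j/K gives a harmonic sum, hence the logarithm;
Cauchy–Schwarz over the rounds gives the square root. Uniform exploration only changes the sampling
distribution, at the cost of a factor `Nat.card A`. -/

theorem lintegral_stepKernel (π : Kernel X A) (C : Kernel (X × A) ℝ) (P : Kernel (X × A) X)
    [IsMarkovKernel π] [IsMarkovKernel C] [IsMarkovKernel P] (x : X)
    {g : Transition X A → ℝ≥0∞} (hg : Measurable g) :
    ∫⁻ t, g t ∂(stepKernel π C P x) = ∫⁻ a, ∫⁻ y, g ((x, a), y) ∂((C ×ₖ P) (x, a)) ∂(π x) := by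
  rw [stepKernel, Kernel.lintegral_compProd _ _ _ hg, Kernel.lintegral_id_prod]
  · rfl
  · exact Measurable.lintegral_kernel_prod_right' (κ := C ×ₖ P) hg

instance isMarkovKernel_stepKernel (π : Kernel X A) (C : Kernel (X × A) ℝ) (P : Kernel (X × A) X)
    [IsMarkovKernel π] [IsMarkovKernel C] [IsMarkovKernel P] :
    IsMarkovKernel (stepKernel π C P) := by
  unfold stepKernel; infer_instance

theorem measurable_consTransition (n : ℕ) :
    Measurable (fun q : Transition X A × (Fin n → Transition X A) =>
      (Fin.cons q.1 q.2 : Fin (n + 1) → Transition X A)) := by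
  refine measurable_pi_iff.2 fun i => ?_
  refine Fin.cases ?_ (fun j => ?_) i
  · simpa using measurable_fst
  · simpa using (by fun_prop : Measurable fun q : Transition X A × (Fin n → Transition X A) => q.2 j)

instance isMarkovKernel_trajKernel : ∀ (n : ℕ) (π : Fin n → Kernel X A)
    (C : Fin n → Kernel (X × A) ℝ) (P : Fin n → Kernel (X × A) X)
    [∀ i, IsMarkovKernel (π i)] [∀ i, IsMarkovKernel (C i)] [∀ i, IsMarkovKernel (P i)],
    IsMarkovKernel (trajKernel n π C P)
  | 0, _, _, _, _, _, _ => by unfold trajKernel; infer_instance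
  | n + 1, π, C, P, _, _, _ => by
    have := isMarkovKernel_trajKernel n (fun i => π i.succ) (fun i => C i.succ) (fun i => P i.succ)
    unfold trajKernel
    exact Kernel.IsMarkovKernel.map _ (measurable_consTransition n)

theorem lintegral_trajKernel_succ (n : ℕ) (π : Fin (n + 1) → Kernel X A)
    (C : Fin (n + 1) → Kernel (X × A) ℝ) (P : Fin (n + 1) → Kernel (X × A) X)
    [∀ i, IsMarkovKernel (π i)] [∀ i, IsMarkovKernel (C i)] [∀ i, IsMarkovKernel (P i)] (x : X)
    {g : (Fin (n + 1) → Transition X A) → ℝ≥0∞} (hg : Measurable g) :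
    ∫⁻ τ, g τ ∂(trajKernel (n + 1) π C P x) =
      ∫⁻ t, ∫⁻ τ, g (Fin.cons t τ) ∂(trajKernel n (fun i => π i.succ) (fun i => C i.succ)
        (fun i => P i.succ) t.2.2) ∂(stepKernel (π 0) (C 0) (P 0) x) := by
  rw [trajKernel, Kernel.map_apply _ (measurable_consTransition n),
    lintegral_map hg (measurable_consTransition n),
    Kernel.lintegral_compProd _ _ _
      (f := fun q => g (Fin.cons q.1 q.2)) (hg.comp (measurable_consTransition n))]
  rfl

/-- Given the state at step `h`, the transition at step `h` follows the step kernel. -/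
theorem lintegral_trajKernel_apply : ∀ (n : ℕ) (π : Fin n → Kernel X A)
    (C : Fin n → Kernel (X × A) ℝ) (P : Fin n → Kernel (X × A) X)
    [∀ i, IsMarkovKernel (π i)] [∀ i, IsMarkovKernel (C i)] [∀ i, IsMarkovKernel (P i)]
    (h : Fin n) (x : X) {g : Transition X A → ℝ≥0∞} (_ : Measurable g),
    ∫⁻ τ, g (τ h) ∂(trajKernel n π C P x) =
      ∫⁻ τ, ∫⁻ t, g t ∂(stepKernel (π h) (C h) (P h) (τ h).1.1) ∂(trajKernel n π C P x)
  | 0, _, _, _, _, _, _, h, _, _, _ => h.elim0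
  | n + 1, π, C, P, _, _, _, h, x, g, hg => by
    have hs : Measurable fun y => ∫⁻ t, g t ∂(stepKernel (π h) (C h) (P h) y) :=
      hg.lintegral_kernel
    rw [lintegral_trajKernel_succ (g := fun τ => g (τ h)) _ _ _ _ _
        (hg.comp (measurable_pi_apply h)),
      lintegral_trajKernel_succ (g := fun τ => ∫⁻ t, g t ∂(stepKernel (π h) (C h) (P h) (τ h).1.1))
        _ _ _ _ _ (hs.comp (by fun_prop))]
    induction h using Fin.cases with
    | zero =>
      simp only [Fin.cons_zero, lintegral_const, measure_univ, mul_one]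
      rw [lintegral_stepKernel (π 0) (C 0) (P 0) x
        (g := fun t => ∫⁻ s, g s ∂(stepKernel (π 0) (C 0) (P 0) t.1.1)) (hs.comp (by fun_prop))]
      simp [lintegral_stepKernel _ _ _ x hg]
    | succ h =>
      simp only [Fin.cons_succ]
      exact lintegral_congr fun t => lintegral_trajKernel_apply n _ _ _ h _ hg

/-- The state at step `h` depends on the policy before step `h` only. -/
theorem lintegral_trajKernel_state_congr : ∀ (n : ℕ) (π π' : Fin n → Kernel X A)
    (C : Fin n → Kernel (X × A) ℝ) (P : Fin n → Kernel (X × A) X)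
    [∀ i, IsMarkovKernel (π i)] [∀ i, IsMarkovKernel (π' i)]
    [∀ i, IsMarkovKernel (C i)] [∀ i, IsMarkovKernel (P i)]
    (h : Fin n) (_ : ∀ i < h, π i = π' i) (x : X) {g : X → ℝ≥0∞} (_ : Measurable g),
    ∫⁻ τ, g (τ h).1.1 ∂(trajKernel n π C P x) = ∫⁻ τ, g (τ h).1.1 ∂(trajKernel n π' C P x)
  | 0, _, _, _, _, _, _, _, _, h, _, _, _, _ => h.elim0
  | n + 1, π, π', C, P, _, _, _, _, h, hπ, x, g, hg => by
    have hs : Measurable fun τ : Fin (n + 1) → Transition X A => g (τ h).1.1 :=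
      hg.comp (by fun_prop)
    rw [lintegral_trajKernel_succ _ _ _ _ _ hs, lintegral_trajKernel_succ _ _ _ _ _ hs]
    induction h using Fin.cases with
    | zero =>
      have hg' : Measurable fun t : Transition X A => g t.1.1 := hg.comp (by fun_prop)
      simp [lintegral_stepKernel _ _ _ x hg']
    | succ h =>
      simp only [Fin.cons_succ]
      rw [hπ 0 (Fin.succ_pos h)]
      exact lintegral_congr fun t => lintegral_trajKernel_state_congr n _ _ _ _ h
        (fun i hi => hπ i.succ (Fin.succ_lt_succ_iff.2 hi)) _ hg

theorem lintegral_trajKernel_zero (n : ℕ) (π : Fin (n + 1) → Kernel X A)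
    (C : Fin (n + 1) → Kernel (X × A) ℝ) (P : Fin (n + 1) → Kernel (X × A) X)
    [∀ i, IsMarkovKernel (π i)] [∀ i, IsMarkovKernel (C i)] [∀ i, IsMarkovKernel (P i)] (x : X)
    {g : X → ℝ≥0∞} (hg : Measurable g) :
    ∫⁻ τ, g (τ 0).1.1 ∂(trajKernel (n + 1) π C P x) = g x := by
  have hs : Measurable fun τ : Fin (n + 1) → Transition X A => g (τ 0).1.1 :=
    hg.comp (by fun_prop)
  have hg' : Measurable fun t : Transition X A => g t.1.1 := hg.comp (by fun_prop)
  rw [lintegral_trajKernel_succ _ _ _ _ _ hs]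
  simp [lintegral_stepKernel _ _ _ x hg']

/-- The state at step `h + 1` has the law of the state reached from step `h`. -/
theorem lintegral_trajKernel_next : ∀ (n : ℕ) (π : Fin n → Kernel X A)
    (C : Fin n → Kernel (X × A) ℝ) (P : Fin n → Kernel (X × A) X)
    [∀ i, IsMarkovKernel (π i)] [∀ i, IsMarkovKernel (C i)] [∀ i, IsMarkovKernel (P i)]
    (h : ℕ) (hn : h + 1 < n) (x : X) {g : X → ℝ≥0∞} (_ : Measurable g),
    ∫⁻ τ, g (τ ⟨h + 1, hn⟩).1.1 ∂(trajKernel n π C P x) =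
      ∫⁻ τ, g (τ ⟨h, by omega⟩).2.2 ∂(trajKernel n π C P x)
  | 0, _, _, _, _, _, _, h, hn, _, _, _ => by omega
  | 1, _, _, _, _, _, _, h, hn, _, _, _ => by omega
  | n + 2, π, C, P, _, _, _, h, hn, x, g, hg => by
    have hs : Measurable fun τ : Fin (n + 2) → Transition X A => g (τ ⟨h + 1, hn⟩).1.1 :=
      hg.comp (by fun_prop)
    have hs' : Measurable fun τ : Fin (n + 2) → Transition X A => g (τ ⟨h, by omega⟩).2.2 :=
      hg.comp (by fun_prop)
    rw [lintegral_trajKernel_succ _ _ _ _ _ hs, lintegral_trajKernel_succ _ _ _ _ _ hs']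
    refine lintegral_congr fun t => ?_
    cases h with
    | zero =>
      have e : (⟨0 + 1, hn⟩ : Fin (n + 2)) = Fin.succ 0 := rfl
      have e' : (⟨0, by omega⟩ : Fin (n + 2)) = 0 := rfl
      simp only [e, e', Fin.cons_succ, Fin.cons_zero]
      rw [lintegral_trajKernel_zero _ _ _ _ _ hg]
      simp
    | succ h =>
      have e : (⟨h + 1 + 1, hn⟩ : Fin (n + 2)) = Fin.succ ⟨h + 1, by omega⟩ := rfl
      have e' : (⟨h + 1, by omega⟩ : Fin (n + 2)) = Fin.succ ⟨h, by omega⟩ := rfl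
      simp only [e, e', Fin.cons_succ]
      exact lintegral_trajKernel_next (n + 1) _ _ _ h (by omega) _ hg

/-- The trajectory kernel for policies with a parameter. -/
noncomputable def paramTrajKernel : (n : ℕ) → (Fin n → Kernel (Z × X) A) →
    (Fin n → Kernel (X × A) ℝ) → (Fin n → Kernel (X × A) X) →
    Kernel (Z × X) (Fin n → Transition X A)
  | 0, _, _, _ => Kernel.const (Z × X) (Measure.dirac Fin.elim0)
  | n + 1, π, C, P =>
    (((Kernel.deterministic Prod.snd measurable_snd ×ₖ π 0) ⊗ₖ
        Kernel.prodMkLeft (Z × X) (C 0 ×ₖ P 0)) ⊗ₖ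
      (paramTrajKernel n (fun i => π i.succ) (fun i => C i.succ) (fun i => P i.succ)).comap
        (fun p : (Z × X) × Transition X A => (p.1.1, p.2.2.2)) (by fun_prop)).map
      (fun q => (Fin.cons q.1 q.2 : Fin (n + 1) → Transition X A))

instance isMarkovKernel_paramTrajKernel : ∀ (n : ℕ) (π : Fin n → Kernel (Z × X) A)
    (C : Fin n → Kernel (X × A) ℝ) (P : Fin n → Kernel (X × A) X)
    [∀ i, IsMarkovKernel (π i)] [∀ i, IsMarkovKernel (C i)] [∀ i, IsMarkovKernel (P i)],
    IsMarkovKernel (paramTrajKernel n π C P)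
  | 0, _, _, _, _, _, _ => by unfold paramTrajKernel; infer_instance
  | n + 1, π, C, P, _, _, _ => by
    have := isMarkovKernel_paramTrajKernel n (fun i => π i.succ) (fun i => C i.succ)
      (fun i => P i.succ)
    unfold paramTrajKernel
    exact Kernel.IsMarkovKernel.map _ (measurable_consTransition n)

/-- Fixing the parameter gives back the ordinary trajectory law. Since the left side is a kernel,
the law of a roll-in is measurable in the history on which the policy depends. -/
theorem paramTrajKernel_apply : ∀ (n : ℕ) (π : Fin n → Kernel (Z × X) A)
    (C : Fin n → Kernel (X × A) ℝ) (P : Fin n → Kernel (X × A) X)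
    [∀ i, IsMarkovKernel (π i)] [∀ i, IsMarkovKernel (C i)] [∀ i, IsMarkovKernel (P i)]
    (z : Z) (x : X),
    paramTrajKernel n π C P (z, x) = trajKernel n (fun i => (π i).sectR z) C P x
  | 0, _, _, _, _, _, _, _, _ => rfl
  | n + 1, π, C, P, _, _, _, z, x => by
    rw [paramTrajKernel, trajKernel, Kernel.map_apply _ (measurable_consTransition n),
      Kernel.map_apply _ (measurable_consTransition n),
      Kernel.compProd_apply_eq_compProd_sectR _ _ (z, x),
      Kernel.compProd_apply_eq_compProd_sectR _ _ x]
    congr 1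
    refine congrArg₂ (fun μ κ => μ ⊗ₘ κ) ?_ ?_
    · rw [stepKernel, Kernel.compProd_apply_eq_compProd_sectR,
        Kernel.compProd_apply_eq_compProd_sectR, Kernel.prod_apply, Kernel.prod_apply]
      rfl
    · ext1 t
      exact paramTrajKernel_apply n _ _ _ z _

end Trajectory

/-! ### Marginals of a roll-in and of one round of data. -/

section RollIn

variable {X A : Type*} [MeasurableSpace X] [MeasurableSpace A] {H : ℕ}

instance isProbabilityMeasure_rollIn (M : MDP X A H) (π : Fin H → Kernel X A)
    [∀ h, IsMarkovKernel (π h)] : IsProbabilityMeasure (rollIn M π) := by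
  unfold rollIn; infer_instance

theorem map_rollIn_stateAction (M : MDP X A H) (π : Fin H → Kernel X A)
    [∀ h, IsMarkovKernel (π h)] (h : Fin H) :
    (rollIn M π).map (fun τ => (τ h).1) = ((rollIn M π).map (fun τ => (τ h).1.1)) ⊗ₘ π h := by
  refine Measure.ext_of_lintegral _ fun g hg => ?_
  have hg' : Measurable fun t : Transition X A => g t.1 := hg.comp measurable_fst
  rw [lintegral_map hg (by fun_prop), Measure.lintegral_compProd hg,
    lintegral_map hg.lintegral_kernel_prod_right' (by fun_prop), rollIn,
    lintegral_trajKernel_apply H π M.C M.P h M.init hg']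
  refine lintegral_congr fun τ => ?_
  simp [lintegral_stepKernel _ _ _ _ hg']

theorem map_rollIn_transition (M : MDP X A H) (π : Fin H → Kernel X A)
    [∀ h, IsMarkovKernel (π h)] (h : Fin H) :
    (rollIn M π).map (fun τ => τ h) =
      ((rollIn M π).map (fun τ => (τ h).1)) ⊗ₘ (M.C h ×ₖ M.P h) := by
  refine Measure.ext_of_lintegral _ fun g hg => ?_
  rw [map_rollIn_stateAction, lintegral_map hg (by fun_prop), Measure.lintegral_compProd hg,
    Measure.lintegral_compProd hg.lintegral_kernel_prod_right',
    lintegral_map hg.lintegral_kernel_prod_right'.lintegral_kernel_prod_right' (by fun_prop),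
    rollIn, lintegral_trajKernel_apply H π M.C M.P h M.init hg]
  exact lintegral_congr fun τ => lintegral_stepKernel _ _ _ _ hg

theorem map_rollIn_state_congr (M : MDP X A H) (π π' : Fin H → Kernel X A)
    [∀ h, IsMarkovKernel (π h)] [∀ h, IsMarkovKernel (π' h)] (h : Fin H)
    (hπ : ∀ i < h, π i = π' i) :
    (rollIn M π).map (fun τ => (τ h).1.1) = (rollIn M π').map (fun τ => (τ h).1.1) := by
  refine Measure.ext_of_lintegral _ fun g hg => ?_
  rw [lintegral_map hg (by fun_prop), lintegral_map hg (by fun_prop)]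
  exact lintegral_trajKernel_state_congr H π π' M.C M.P h hπ M.init hg

theorem map_rollIn_init [NeZero H] (M : MDP X A H) (π : Fin H → Kernel X A)
    [∀ h, IsMarkovKernel (π h)] :
    (rollIn M π).map (fun τ => (τ 0).1.1) = Measure.dirac M.init := by
  obtain _ | n := H
  · exact absurd rfl (NeZero.ne 0)
  refine Measure.ext_of_lintegral _ fun g hg => ?_
  rw [lintegral_map hg (by fun_prop), lintegral_dirac' _ hg]
  exact lintegral_trajKernel_zero n π M.C M.P M.init hg

theorem map_rollIn_next (M : MDP X A H) (π : Fin H → Kernel X A)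
    [∀ h, IsMarkovKernel (π h)] (h : ℕ) (hh : h + 1 < H) :
    (rollIn M π).map (fun τ => (τ ⟨h + 1, hh⟩).1.1) =
      (rollIn M π).map (fun τ => (τ ⟨h, by omega⟩).2.2) := by
  refine Measure.ext_of_lintegral _ fun g hg => ?_
  rw [lintegral_map hg (by fun_prop), lintegral_map hg (by fun_prop)]
  exact lintegral_trajKernel_next H π M.C M.P h hh M.init hg

theorem isMarkovKernel_uniformAct [MeasurableSingletonClass A] [Finite A] [Nonempty A] :
    IsMarkovKernel (uniformAct X A) := by
  have : IsProbabilityMeasure (uniformOn (Set.univ : Set A)) :=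
    isProbabilityMeasure_uniformOn Set.finite_univ Set.univ_nonempty
  unfold uniformAct
  infer_instance

theorem isMarkovKernel_update (π : Fin H → Kernel X A) [∀ h, IsMarkovKernel (π h)]
    (h : Fin H) (κ : Kernel X A) [IsMarkovKernel κ] (i : Fin H) :
    IsMarkovKernel (Function.update π h κ i) := by
  by_cases hi : i = h
  · subst hi; rwa [Function.update_self]
  · rw [Function.update_of_ne hi]; infer_instance

/-- The state-action distribution at step `h` under which the data of one round are gathered. -/
noncomputable def explored (M : MDP X A H) (ua : Bool) (π : Policy X A H) (h : Fin H) :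
    Measure (X × A) :=
  if ua then stateVisit M π h ⊗ₘ uniformAct X A else visit M π h

variable [MeasurableSingletonClass A] [Nonempty A]

theorem isProbabilityMeasure_gather (M : MDP X A H) (ua : Bool) (hua : ua = true → Finite A)
    (π : Policy X A H) : IsProbabilityMeasure (gather M ua π) := by
  unfold gather
  split_ifs with h
  · have := hua h
    have := isMarkovKernel_uniformAct (X := X) (A := A)
    have := fun h => isMarkovKernel_update π.act h (uniformAct X A)
    have : ∀ h, IsProbabilityMeasure ((rollIn M (Function.update π.act h (uniformAct X A))).map
        (fun τ => τ h)) := fun h => Measure.isProbabilityMeasure_map (measurable_pi_apply h).aemeasurable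
    infer_instance
  · infer_instance

/-- Both exploration modes produce the same conditional law of cost and next state; only the
state-action marginal differs. All later concentration arguments use this form alone. -/
theorem map_gather (M : MDP X A H) (ua : Bool) (hua : ua = true → Finite A)
    (π : Policy X A H) (h : Fin H) :
    (gather M ua π).map (fun d => d h) = explored M ua π h ⊗ₘ (M.C h ×ₖ M.P h) := by
  unfold gather explored
  split_ifs with hu
  · have := hua hu
    have := isMarkovKernel_uniformAct (X := X) (A := A)
    have := fun h => isMarkovKernel_update π.act h (uniformAct X A)
    have : ∀ h, IsProbabilityMeasure ((rollIn M (Function.update π.act h (uniformAct X A))).map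
        (fun τ => τ h)) := fun h => Measure.isProbabilityMeasure_map (measurable_pi_apply h).aemeasurable
    have e := Measure.pi_map_eval
      (μ := fun h => (rollIn M (Function.update π.act h (uniformAct X A))).map (fun τ => τ h)) h
    simp only [measure_univ, Finset.prod_const_one, one_smul] at e
    refine e.trans ?_
    rw [map_rollIn_transition, map_rollIn_stateAction, Function.update_self, stateVisit]
    -- Replacing the action kernel at step `h` does not affect the state reached there.
    rw [map_rollIn_state_congr M (Function.update π.act h (uniformAct X A)) π.act h]
    exact fun i hi => Function.update_of_ne hi.ne _ _
  · exact map_rollIn_transition M π.act h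

end RollIn

/-! ### Measurable dependence on the history, and stopped products. -/

section Measurability

variable {X A Z : Type*} [MeasurableSpace X] [MeasurableSpace A] [MeasurableSpace Z] {H : ℕ}

theorem measurable_rollIn (M : MDP X A H) (π : Fin H → Kernel (Z × X) A)
    [∀ h, IsMarkovKernel (π h)] :
    Measurable fun z => rollIn M (fun h => (π h).sectR z) := by
  simp_rw [rollIn, ← paramTrajKernel_apply]
  exact (Kernel.measurable _).comp (by fun_prop)

/-- Measurable boxes form a generating π-system, and on them a product measure is a finite product
of measurable functions. -/
theorem measurable_pi_measure {ι : Type*} [Fintype ι] {α : ι → Type*} [∀ i, MeasurableSpace (α i)]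
    (μ : Z → ∀ i, Measure (α i)) [∀ z i, IsProbabilityMeasure (μ z i)]
    (hμ : ∀ i, Measurable fun z => μ z i) : Measurable fun z => Measure.pi (μ z) := by
  refine Measurable.measure_of_isPiSystem_of_isProbabilityMeasure generateFrom_pi.symm
    isPiSystem_pi ?_
  rintro _ ⟨s, hs, rfl⟩
  simp_rw [Measure.pi_pi]
  exact Finset.measurable_prod _ fun i _ =>
    (Measure.measurable_coe (hs i (Set.mem_univ i))).comp (hμ i)

theorem measurable_gather [MeasurableSingletonClass A] [Nonempty A] (M : MDP X A H) (ua : Bool)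
    (hua : ua = true → Finite A) (π : Fin H → Kernel (Z × X) A) [∀ h, IsMarkovKernel (π h)] :
    Measurable fun z => gather M ua ⟨fun h => (π h).sectR z, fun _ => inferInstance⟩ := by
  unfold gather
  split_ifs with hu
  · have := hua hu
    have := isMarkovKernel_uniformAct (X := X) (A := A)
    have := fun (z : Z) h => isMarkovKernel_update (fun h => (π h).sectR z) h (uniformAct X A)
    have := fun h => isMarkovKernel_update π h (Kernel.prodMkLeft Z (uniformAct X A))
    have : ∀ (z : Z) h, IsProbabilityMeasure
        ((rollIn M (Function.update (fun h => (π h).sectR z) h (uniformAct X A))).map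
          (fun τ => τ h)) := fun z h =>
          Measure.isProbabilityMeasure_map (measurable_pi_apply h).aemeasurable
    refine measurable_pi_measure _ fun h => ?_
    -- Updating with a parameter-independent kernel commutes with fixing the parameter, so the
    -- roll-in is again of the form covered by `measurable_rollIn`.
    have e : ∀ z, Function.update (fun h => (π h).sectR z) h (uniformAct X A) =
        fun i => (Function.update π h (Kernel.prodMkLeft Z (uniformAct X A)) i).sectR z := by
      intro z
      funext i
      by_cases hi : i = h
      · subst hi; simp
      · simp [Function.update_of_ne hi]
    simp_rw [e]
    exact (Measure.measurable_map _ (by fun_prop)).comp (measurable_rollIn M _)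
  · exact measurable_rollIn M π

theorem measurable_snocHistory (k : ℕ) :
    Measurable (fun q : History X A H k × RoundData X A H =>
      (Fin.snoc q.1 q.2 : History X A H (k + 1))) := by
  refine measurable_pi_iff.2 fun i => ?_
  refine Fin.lastCases ?_ (fun j => ?_) i
  · simpa using measurable_snd
  · simpa using (by fun_prop : Measurable fun q : History X A H k × RoundData X A H => q.1 j)

/-- The product of the weights `w`, stopped when it reaches `a`. -/
noncomputable def stoppedWeight (w : (k : ℕ) → History X A H k → RoundData X A H → ℝ≥0∞)
    (a : ℝ≥0∞) : (k : ℕ) → History X A H k → ℝ≥0∞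
  | 0, _ => 1
  | k + 1, D => if a ≤ stoppedWeight w a k (fun i => D i.castSucc) then
      stoppedWeight w a k (fun i => D i.castSucc)
    else stoppedWeight w a k (fun i => D i.castSucc) *
      w k (fun i => D i.castSucc) (D (Fin.last k))

theorem measurable_stoppedWeight {w : (k : ℕ) → History X A H k → RoundData X A H → ℝ≥0∞}
    (hw : ∀ k, Measurable (Function.uncurry (w k))) (a : ℝ≥0∞) :
    ∀ k, Measurable (stoppedWeight w a k)
  | 0 => measurable_const
  | k + 1 => by
    have h1 : Measurable fun D : History X A H (k + 1) => fun i : Fin k => D i.castSucc := by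
      fun_prop
    have h2 := (measurable_stoppedWeight hw a k).comp h1
    exact Measurable.ite (measurableSet_le measurable_const h2) h2
      (h2.mul ((hw k).comp (h1.prodMk (measurable_pi_apply _))))

end Measurability

/-! ### The law of the whole interaction and Ville's inequality. -/

section History

variable {X A : Type*} [MeasurableSpace X] [MeasurableSpace A] [MeasurableSingletonClass A]
  [Nonempty A] {H : ℕ}

/-- The law of the data of round `k`, given the data of the rounds before. -/
noncomputable def gatherKernel (M : MDP X A H) (ua : Bool) (hua : ua = true → Finite A) {k : ℕ}
    (π : Fin H → Kernel (History X A H k × X) A) [∀ h, IsMarkovKernel (π h)] :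
    Kernel (History X A H k) (RoundData X A H) :=
  ⟨fun D => gather M ua (policyAt π D), measurable_gather M ua hua π⟩

instance isMarkovKernel_gatherKernel (M : MDP X A H) (ua : Bool) (hua : ua = true → Finite A)
    {k : ℕ} (π : Fin H → Kernel (History X A H k × X) A) [∀ h, IsMarkovKernel (π h)] :
    IsMarkovKernel (gatherKernel M ua hua π) :=
  ⟨fun _ => isProbabilityMeasure_gather M ua hua _⟩

theorem lintegral_historyLaw_succ (M : MDP X A H) (ua : Bool) (hua : ua = true → Finite A)
    (π : (k : ℕ) → Fin H → Kernel (History X A H k × X) A) [∀ k h, IsMarkovKernel (π k h)] (k : ℕ)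
    {g : History X A H (k + 1) → ℝ≥0∞} (hg : Measurable g) :
    ∫⁻ D, g D ∂(historyLaw M ua π (k + 1)) =
      ∫⁻ D, ∫⁻ d, g (Fin.snoc D d : History X A H (k + 1)) ∂(gatherKernel M ua hua (π k) D)
        ∂(historyLaw M ua π k) := by
  have hs : ∀ D : History X A H k, Measurable fun d : RoundData X A H =>
      (Fin.snoc D d : History X A H (k + 1)) :=
    fun D => (measurable_snocHistory k).comp measurable_prodMk_left
  rw [historyLaw, Measure.lintegral_bind _ hg.aemeasurable]
  · exact lintegral_congr fun D => lintegral_map hg (hs D)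
  -- Integrating against `bind` needs measurability in `D`, which is read off from a kernel.
  · have e : (fun D => (gather M ua (policyAt (π k) D)).map
        (fun d => (Fin.snoc D d : Fin (k + 1) → RoundData X A H))) =
        fun D => ((Kernel.id ×ₖ gatherKernel M ua hua (π k)).map
          (fun q => (Fin.snoc q.1 q.2 : History X A H (k + 1)))) D := by
      funext D
      refine Measure.ext_of_lintegral _ fun g hg => ?_
      rw [Kernel.map_apply _ (measurable_snocHistory k), lintegral_map hg (measurable_snocHistory k),
        Kernel.lintegral_id_prod
          (f := fun q => g (Fin.snoc q.1 q.2 : History X A H (k + 1)))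
          (hg.comp (measurable_snocHistory k)), lintegral_map hg (hs D)]
      rfl
    rw [e]
    exact (Kernel.measurable _).aemeasurable

theorem isProbabilityMeasure_historyLaw (M : MDP X A H) (ua : Bool) (hua : ua = true → Finite A)
    (π : (k : ℕ) → Fin H → Kernel (History X A H k × X) A) [∀ k h, IsMarkovKernel (π k h)] :
    ∀ k, IsProbabilityMeasure (historyLaw M ua π k)
  | 0 => by unfold historyLaw; infer_instance
  | k + 1 => by
    have := isProbabilityMeasure_historyLaw M ua hua π k
    constructor
    rw [← lintegral_one, lintegral_historyLaw_succ M ua hua π k measurable_const]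
    simp

/-- The stopped product is a nonnegative supermartingale started at 1: after stopping it is
constant, and before it is multiplied by a factor of conditional mean at most 1. -/
theorem lintegral_stoppedWeight_le (M : MDP X A H) (ua : Bool) (hua : ua = true → Finite A)
    (π : (k : ℕ) → Fin H → Kernel (History X A H k × X) A) [∀ k h, IsMarkovKernel (π k h)]
    {w : (k : ℕ) → History X A H k → RoundData X A H → ℝ≥0∞}
    (hw : ∀ k, Measurable (Function.uncurry (w k)))
    (hw1 : ∀ k D, ∫⁻ d, w k D d ∂(gather M ua (policyAt (π k) D)) ≤ 1) (a : ℝ≥0∞) :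
    ∀ k, ∫⁻ D, stoppedWeight w a k D ∂(historyLaw M ua π k) ≤ 1
  | 0 => by simp [stoppedWeight, historyLaw]
  | k + 1 => by
    rw [lintegral_historyLaw_succ M ua hua π k (measurable_stoppedWeight hw a (k + 1))]
    refine le_trans (lintegral_mono fun D => ?_) (lintegral_stoppedWeight_le M ua hua π hw hw1 a k)
    simp only [stoppedWeight, Fin.snoc_castSucc, Fin.snoc_last]
    split_ifs
    · simp
    · have hwk : Measurable (w k D) := (hw k).comp measurable_prodMk_left
      exact (lintegral_const_mul _ hwk).trans_le (mul_le_of_le_one_right' (hw1 k D))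

/-- **Ville's inequality** for the data gathered by the algorithm. -/
theorem historyLaw_exists_le_sum (M : MDP X A H) (ua : Bool) (hua : ua = true → Finite A)
    (π : (k : ℕ) → Fin H → Kernel (History X A H k × X) A) [∀ k h, IsMarkovKernel (π k h)]
    {z : (k : ℕ) → History X A H k → RoundData X A H → ℝ}
    (hz : ∀ k, Measurable (Function.uncurry (z k)))
    (hz1 : ∀ k D, ∫⁻ d, ENNReal.ofReal (Real.exp (z k D d)) ∂(gather M ua (policyAt (π k) D)) ≤ 1)
    (b : ℝ) (K : ℕ) :
    historyLaw M ua π K {D | ∃ (k : ℕ) (hk : k ≤ K),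
      b ≤ ∑ i : Fin k, z i (fun j => D (Fin.castLE (i.2.le.trans hk) j)) (D (Fin.castLE hk i))} ≤
        ENNReal.ofReal (Real.exp (-b)) := by
  set w : (k : ℕ) → History X A H k → RoundData X A H → ℝ≥0∞ :=
    fun k D d => ENNReal.ofReal (Real.exp (z k D d)) with hw_def
  have hw : ∀ k, Measurable (Function.uncurry (w k)) := fun k =>
    ENNReal.measurable_ofReal.comp (Real.measurable_exp.comp (hz k))
  set a : ℝ≥0∞ := ENNReal.ofReal (Real.exp b)
  -- Below the threshold no stopping has occurred, so the value is the full product.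
  have key : ∀ (k : ℕ) (D : History X A H k), stoppedWeight w a k D < a →
      stoppedWeight w a k D = ENNReal.ofReal (Real.exp
        (∑ i : Fin k, z i (fun j => D (Fin.castLE i.2.le j)) (D i))) := by
    intro k
    induction k with
    | zero => intro D _; simp [stoppedWeight]
    | succ k ih =>
      intro D hD
      by_cases h : a ≤ stoppedWeight w a k (fun i => D i.castSucc)
      · rw [stoppedWeight, if_pos h] at hD
        exact absurd h (not_le.2 hD)
      · rw [stoppedWeight, if_neg h, ih _ (not_le.1 h), Fin.sum_univ_castSucc, Real.exp_add,
          ENNReal.ofReal_mul (Real.exp_nonneg _)]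
        rfl
  -- Once the threshold is reached the value is frozen. A crossing at any time is thus visible at
  -- time `K`, where Markov's inequality applies.
  have mono : ∀ (K k : ℕ) (hk : k ≤ K) (D : History X A H K),
      a ≤ stoppedWeight w a k (fun i => D (Fin.castLE hk i)) → a ≤ stoppedWeight w a K D := by
    intro K
    induction K with
    | zero => intro k hk D h; obtain rfl : k = 0 := by omega
              exact h
    | succ K ih =>
      intro k hk D h
      rcases Nat.lt_or_ge K k with h' | h'
      · obtain rfl : k = K + 1 := by omega
        exact h
      · have := ih k h' (fun i => D i.castSucc) h
        rw [stoppedWeight, if_pos this]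
        exact this
  have hsub : {D | ∃ (k : ℕ) (hk : k ≤ K), b ≤ ∑ i : Fin k,
      z i (fun j => D (Fin.castLE (i.2.le.trans hk) j)) (D (Fin.castLE hk i))} ⊆
      {D : History X A H K | a ≤ stoppedWeight w a K D} := by
    rintro D ⟨k, hk, h⟩
    refine mono K k hk D ?_
    by_contra hlt
    have e := key k _ (not_le.1 hlt)
    rw [e] at hlt
    exact hlt (ENNReal.ofReal_le_ofReal (Real.exp_le_exp.2 h))
  have ha : a ≠ 0 := by simpa [a] using Real.exp_pos b
  calc _ ≤ historyLaw M ua π K {D : History X A H K | a ≤ stoppedWeight w a K D} :=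
        measure_mono hsub
    _ ≤ (∫⁻ D, stoppedWeight w a K D ∂(historyLaw M ua π K)) / a :=
        meas_ge_le_lintegral_div (measurable_stoppedWeight hw a K).aemeasurable ha
          ENNReal.ofReal_ne_top
    _ ≤ 1 / a := ENNReal.div_le_div_right (lintegral_stoppedWeight_le M ua hua π hw hz1 a K) _
    _ = ENNReal.ofReal (Real.exp (-b)) := by
        rw [one_div, Real.exp_neg, ENNReal.ofReal_inv_of_pos (Real.exp_pos b)]

end History

/-! ### Exponential moments of the excess TD loss. -/

section Concentration

/-- Follows from e^u ≥ 1 + u and (1 + u)(1 - u/2) ≥ 1 on the unit interval. Being affine in `u`, the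
bound can be averaged over the state-action pair. -/
theorem exp_neg_le_one_sub_half {u : ℝ} (h0 : 0 ≤ u) (h1 : u ≤ 1) : Real.exp (-u) ≤ 1 - u / 2 := by
  have h2 := Real.add_one_le_exp u
  have h3 : Real.exp (-u) * Real.exp u = 1 := by rw [← Real.exp_add]; simp
  have h4 := Real.exp_pos (-u)
  have h5 : Real.exp (-u) * (1 + u) ≤ 1 := by nlinarith
  nlinarith [mul_nonneg h0 (sub_nonneg.2 h1)]

variable {X A : Type*} [MeasurableSpace X] [MeasurableSpace A] {H : ℕ}

/-- The excess of the squared TD loss of `g` over the one of the Bellman backup of `g'`. -/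
noncomputable def excessLoss (M : MDP X A H) (h : Fin H) (g g' : X × A → ℝ)
    (t : Transition X A) : ℝ :=
  (g t.1 - (t.2.1 + minAct g' t.2.2)) ^ 2 - (bellman M h g' t.1 - (t.2.1 + minAct g' t.2.2)) ^ 2

theorem tdLoss_sub_tdLoss_bellman (M : MDP X A H) (h : Fin H) (g g' : X × A → ℝ) {k : ℕ}
    (D : History X A H k) :
    tdLoss D h g g' - tdLoss D h (bellman M h g') g' = ∑ i, excessLoss M h g g' (D i h) := by
  simp only [tdLoss, excessLoss, Finset.sum_sub_distrib]

theorem measurable_excessLoss (M : MDP X A H) (h : Fin H) {g g' : X × A → ℝ} (hg : Measurable g)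
    (hg' : Measurable (minAct g')) (hT : Measurable (bellman M h g')) :
    Measurable (excessLoss M h g g') := by
  unfold excessLoss
  have := hg'.comp (measurable_snd.comp measurable_snd : Measurable fun t : Transition X A => t.2.2)
  have h1 := hg.comp (measurable_fst : Measurable fun t : Transition X A => t.1)
  have h2 := hT.comp (measurable_fst : Measurable fun t : Transition X A => t.1)
  simp only [Function.comp_def] at *
  fun_prop

theorem ae_backup_mem (M : MDP X A H) (h : Fin H) {v : X → ℝ}
    (hv : ∀ x, v x ∈ Set.Icc (0 : ℝ) 1) (p : X × A) :
    ∀ᵐ q ∂((M.C h ×ₖ M.P h) p), q.1 + v q.2 ∈ Set.Icc (0 : ℝ) 2 := by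
  have h1 : ∀ᵐ q ∂((M.C h ×ₖ M.P h) p), q.1 ∈ Set.Icc (0 : ℝ) 1 := by
    rw [Kernel.prod_apply]
    exact Measure.quasiMeasurePreserving_fst.ae (M.cost_mem h p)
  filter_upwards [h1] with q hq
  have := hv q.2
  simp only [Set.mem_Icc] at *
  constructor <;> linarith

/-- Hoeffding's lemma: the target lies in [0, 2], so it is sub-Gaussian with variance proxy (2/2)² =
1 about its mean, the Bellman backup. -/
theorem lintegral_exp_backup_le (M : MDP X A H) (h : Fin H) {g' : X × A → ℝ}
    (hg' : Measurable (minAct g')) (hv : ∀ x, minAct g' x ∈ Set.Icc (0 : ℝ) 1) (p : X × A)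
    (t : ℝ) :
    ∫⁻ q, ENNReal.ofReal (Real.exp (t * (q.1 + minAct g' q.2 - bellman M h g' p)))
      ∂((M.C h ×ₖ M.P h) p) ≤ ENNReal.ofReal (Real.exp (t ^ 2 / 2)) := by
  have hm : Measurable fun q : ℝ × X => q.1 + minAct g' q.2 :=
    measurable_fst.add (hg'.comp measurable_snd)
  have hs := hasSubgaussianMGF_of_mem_Icc hm.aemeasurable (ae_backup_mem M h hv p)
  have hi := hs.integrable_exp_mul t
  have hle := hs.mgf_le t
  have e : (((‖(2 : ℝ) - 0‖₊ / 2) ^ 2 : NNReal) : ℝ) = 1 := by simp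
  rw [e, one_mul, mgf] at hle
  change ∫⁻ q, ENNReal.ofReal (Real.exp (t * (q.1 + minAct g' q.2 -
    ∫ y : ℝ × X, (y.1 + minAct g' y.2) ∂((M.C h ×ₖ M.P h) p)))) ∂((M.C h ×ₖ M.P h) p) ≤ _
  rw [← ofReal_integral_eq_lintegral_ofReal hi (Filter.Eventually.of_forall fun _ =>
    Real.exp_nonneg _)]
  exact ENNReal.ofReal_le_ofReal hle

/-- The square of the noise cancels in the excess, leaving Δ² - 2Δ·noise; Hoeffding's lemma is
applied with parameter 2rΔ. -/
theorem lintegral_exp_excessLoss_le (M : MDP X A H) (h : Fin H) (g : X × A → ℝ)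
    {g' : X × A → ℝ}
    (hg' : Measurable (minAct g')) (hv : ∀ x, minAct g' x ∈ Set.Icc (0 : ℝ) 1) (p : X × A)
    (r : ℝ) :
    ∫⁻ q, ENNReal.ofReal (Real.exp (-r * excessLoss M h g g' (p, q))) ∂((M.C h ×ₖ M.P h) p) ≤
      ENNReal.ofReal (Real.exp ((2 * r ^ 2 - r) * (g p - bellman M h g' p) ^ 2)) := by
  set Δ := g p - bellman M h g' p with hΔ
  have e : ∀ q : ℝ × X, ENNReal.ofReal (Real.exp (-r * excessLoss M h g g' (p, q))) =
      ENNReal.ofReal (Real.exp (-r * Δ ^ 2)) * ENNReal.ofReal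
        (Real.exp (2 * r * Δ * (q.1 + minAct g' q.2 - bellman M h g' p))) := by
    intro q
    rw [← ENNReal.ofReal_mul (Real.exp_nonneg _), ← Real.exp_add]
    congr 2
    simp only [excessLoss, hΔ]
    ring
  simp_rw [e]
  rw [lintegral_const_mul' _ _ ENNReal.ofReal_ne_top]
  refine (mul_le_mul_right (lintegral_exp_backup_le M h hg' hv p _) _).trans ?_
  rw [← ENNReal.ofReal_mul (Real.exp_nonneg _), ← Real.exp_add]
  refine ENNReal.ofReal_le_ofReal (Real.exp_le_exp.2 (le_of_eq ?_))
  ring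

variable [MeasurableSingletonClass A] [Nonempty A]

/-- As a marginal of the data law, the exploration distribution inherits total mass 1 and measurable
dependence on the history. -/
theorem map_gather_stateAction (M : MDP X A H) (ua : Bool) (hua : ua = true → Finite A)
    (π : Policy X A H) (h : Fin H) :
    explored M ua π h = (gather M ua π).map (fun d => (d h).1) := by
  have hm := congrArg (fun μ => μ.map Prod.fst) (map_gather M ua hua π h)
  rw [Measure.map_map measurable_fst (measurable_pi_apply h)] at hm
  have hp := isProbabilityMeasure_gather M ua hua π
  have : SFinite (explored M ua π h) := by
    unfold explored; split_ifs <;> [infer_instance; (unfold visit; infer_instance)]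
  have e := Measure.fst_compProd (explored M ua π h) (M.C h ×ₖ M.P h)
  rw [Measure.fst] at e
  rw [← e, ← hm]
  rfl

theorem isProbabilityMeasure_explored (M : MDP X A H) (ua : Bool) (hua : ua = true → Finite A)
    (π : Policy X A H) (h : Fin H) : IsProbabilityMeasure (explored M ua π h) := by
  rw [map_gather_stateAction M ua hua]
  have hp := isProbabilityMeasure_gather M ua hua π
  exact Measure.isProbabilityMeasure_map (measurable_fst.comp (measurable_pi_apply h)).aemeasurable

theorem lintegral_gather (M : MDP X A H) (ua : Bool) (hua : ua = true → Finite A)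
    (π : Policy X A H) (h : Fin H) {φ : Transition X A → ℝ≥0∞} (hφ : Measurable φ) :
    ∫⁻ d, φ (d h) ∂(gather M ua π) =
      ∫⁻ p, ∫⁻ q, φ (p, q) ∂((M.C h ×ₖ M.P h) p) ∂(explored M ua π h) := by
  have := isProbabilityMeasure_explored M ua hua π h
  rw [← Measure.lintegral_compProd hφ, ← map_gather M ua hua π h,
    lintegral_map hφ (measurable_pi_apply h)]

/-- Concentration: the TD loss of the Bellman backup is nearly minimal, uniformly in time. -/
theorem historyLaw_excessLoss (M : MDP X A H) (ua : Bool) (hua : ua = true → Finite A)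
    (π : (k : ℕ) → Fin H → Kernel (History X A H k × X) A) [∀ k h, IsMarkovKernel (π k h)]
    (h : Fin H) {g g' : X × A → ℝ} (hg : Measurable g) (hg' : Measurable (minAct g'))
    (hv : ∀ x, minAct g' x ∈ Set.Icc (0 : ℝ) 1) (hT : Measurable (bellman M h g'))
    (b : ℝ) (K : ℕ) :
    historyLaw M ua π K {D | ∃ (k : ℕ) (hk : k ≤ K),
      b ≤ ∑ i : Fin k, -(1 / 2) * excessLoss M h g g' (D (Fin.castLE hk i) h)} ≤
        ENNReal.ofReal (Real.exp (-b)) := by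
  have hm := measurable_excessLoss M h hg hg' hT
  refine historyLaw_exists_le_sum M ua hua π
    (z := fun k _ d => -(1 / 2) * excessLoss M h g g' (d h)) (fun k => ?_) (fun k D => ?_) b K
  · exact (hm.comp (by fun_prop : Measurable fun q : History X A H k × RoundData X A H =>
      q.2 h)).const_mul _
  · rw [lintegral_gather M ua hua _ h (φ := fun t => ENNReal.ofReal (Real.exp
      (-(1 / 2) * excessLoss M h g g' t))) (by fun_prop)]
    have := isProbabilityMeasure_explored M ua hua (policyAt (π k) D) h
    refine (lintegral_mono (g := fun _ => 1) fun p => ?_).trans (by simp)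
    -- At r = 1/2 the exponent 2r² - r vanishes.
    refine (lintegral_exp_excessLoss_le M h g hg' hv p (1 / 2)).trans ?_
    norm_num

/-- Concentration: the in-sample squared Bellman error is controlled by the TD loss, uniformly in
time. -/
theorem historyLaw_explored (M : MDP X A H) (ua : Bool) (hua : ua = true → Finite A)
    (π : (k : ℕ) → Fin H → Kernel (History X A H k × X) A) [∀ k h, IsMarkovKernel (π k h)]
    (h : Fin H) {g g' : X × A → ℝ} (hg : Measurable g) (hg' : Measurable (minAct g'))
    (hv : ∀ x, minAct g' x ∈ Set.Icc (0 : ℝ) 1) (hT : Measurable (bellman M h g'))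
    (hΔ : ∀ p, (g p - bellman M h g' p) ^ 2 ≤ 1) (b : ℝ) (K : ℕ) :
    historyLaw M ua π K {D | ∃ (k : ℕ) (hk : k ≤ K),
      b ≤ ∑ i : Fin k, (-(1 / 4) * excessLoss M h g g' (D (Fin.castLE hk i) h) +
        1 / 16 * ∫ p, (g p - bellman M h g' p) ^ 2 ∂(explored M ua (policyAt (π i)
          (fun j => D (Fin.castLE (i.2.le.trans hk) j))) h))} ≤
        ENNReal.ofReal (Real.exp (-b)) := by
  have hm := measurable_excessLoss M h hg hg' hT
  have hΔm : Measurable fun p => (g p - bellman M h g' p) ^ 2 := (hg.sub hT).pow_const 2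
  have hI : ∀ k, Measurable fun D : History X A H k =>
      ∫ p, (g p - bellman M h g' p) ^ 2 ∂(explored M ua (policyAt (π k) D) h) := by
    intro k
    have e : ∀ D : History X A H k,
        ∫ p, (g p - bellman M h g' p) ^ 2 ∂(explored M ua (policyAt (π k) D) h) =
        ∫ d, (g (d h).1 - bellman M h g' (d h).1) ^ 2 ∂(gatherKernel M ua hua (π k) D) := by
      intro D
      rw [map_gather_stateAction M ua hua, integral_map
        (by fun_prop : Measurable fun d : RoundData X A H => (d h).1).aemeasurable
        hΔm.aestronglyMeasurable]
      rfl
    simp_rw [e]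
    exact (StronglyMeasurable.integral_kernel (κ := gatherKernel M ua hua (π k))
      (f := fun d : RoundData X A H => (g (d h).1 - bellman M h g' (d h).1) ^ 2)
      (hΔm.comp (by fun_prop : Measurable fun d : RoundData X A H =>
        (d h).1)).stronglyMeasurable).measurable
  refine historyLaw_exists_le_sum M ua hua π
    (z := fun k D d => -(1 / 4) * excessLoss M h g g' (d h) +
      1 / 16 * ∫ p, (g p - bellman M h g' p) ^ 2 ∂(explored M ua (policyAt (π k) D) h))
    (fun k => ?_) (fun k D => ?_) b K
  · exact ((hm.comp (by fun_prop : Measurable fun q : History X A H k × RoundData X A H =>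
      q.2 h)).const_mul _).add (((hI k).comp measurable_fst).const_mul _)
  · have := isProbabilityMeasure_explored M ua hua (policyAt (π k) D) h
    set μ := explored M ua (policyAt (π k) D) h
    set I := ∫ p, (g p - bellman M h g' p) ^ 2 ∂μ
    have hint : Integrable (fun p => (g p - bellman M h g' p) ^ 2) μ :=
      Integrable.of_mem_Icc 0 1 hΔm.aemeasurable
        (Filter.Eventually.of_forall fun p => ⟨sq_nonneg _, hΔ p⟩)
    have e1 : ∀ d : RoundData X A H, ENNReal.ofReal (Real.exp
        (-(1 / 4) * excessLoss M h g g' (d h) + 1 / 16 * I)) =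
        ENNReal.ofReal (Real.exp (1 / 16 * I)) * ENNReal.ofReal (Real.exp
        (-(1 / 4) * excessLoss M h g g' (d h))) := by
      intro d
      rw [add_comm, Real.exp_add, ENNReal.ofReal_mul (Real.exp_nonneg _)]
    simp_rw [e1]
    rw [lintegral_const_mul' _ _ ENNReal.ofReal_ne_top,
      lintegral_gather M ua hua _ h (φ := fun t => ENNReal.ofReal (Real.exp
        (-(1 / 4) * excessLoss M h g g' t))) (by fun_prop)]
    have h1 : ∀ p, ∫⁻ q, ENNReal.ofReal (Real.exp (-(1 / 4) * excessLoss M h g g' (p, q)))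
        ∂((M.C h ×ₖ M.P h) p) ≤
        ENNReal.ofReal (1 - 1 / 16 * (g p - bellman M h g' p) ^ 2) := by
      intro p
      refine (lintegral_exp_excessLoss_le M h g hg' hv p (1 / 4)).trans
        (ENNReal.ofReal_le_ofReal ?_)
      -- At r = 1/4 the coefficient 2r² - r is -1/8; halving it in the affine bound gives 1/16.
      have h2 := exp_neg_le_one_sub_half (u := (g p - bellman M h g' p) ^ 2 / 8)
        (by positivity) (by linarith [hΔ p])
      convert h2 using 2 <;> ring
    have hint' : Integrable (fun p => 1 - 1 / 16 * (g p - bellman M h g' p) ^ 2) μ :=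
      (integrable_const _).sub (hint.const_mul _)
    have h3 : ∫⁻ p, ENNReal.ofReal (1 - 1 / 16 * (g p - bellman M h g' p) ^ 2) ∂μ ≤
        ENNReal.ofReal (Real.exp (-(1 / 16 * I))) := by
      rw [← ofReal_integral_eq_lintegral_ofReal hint'
        (Filter.Eventually.of_forall fun p => by
          have := hΔ p
          simp only [Pi.zero_apply]
          linarith), integral_sub (integrable_const _) (hint.const_mul _),
        integral_const_mul]
      refine ENNReal.ofReal_le_ofReal ?_
      -- After averaging, 1 - I/16 ≤ exp(-I/16) compensates the deterministic factor exp(I/16).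
      have := Real.add_one_le_exp (-(1 / 16 * I))
      simp
      linarith
    refine (mul_le_mul_right ((lintegral_mono h1).trans h3) _).trans ?_
    rw [← ENNReal.ofReal_mul (Real.exp_nonneg _), ← Real.exp_add]
    simp

end Concentration

/-! ### From small past errors to a small sum of current errors. -/

section Eluder

/-- Enumerating `B` increasingly turns it into an admissible sequence in the definition of the
eluder dimension. -/
theorem card_le_of_eluderDim_le {S : Type*} [MeasurableSpace S] {q : ℕ} {Ψ : Set (S → ℝ)}
    {𝓜 : Set (Measure S)} {ε₀ ε : ℝ} {d : ℕ} (hd : eluderDim q Ψ 𝓜 ε₀ ≤ d) (hε : ε₀ ≤ ε)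
    {ι : Type*} [LinearOrder ι] (B : Finset ι) (μ : ι → Measure S) (hμ : ∀ k ∈ B, μ k ∈ 𝓜)
    (ψ : ι → S → ℝ) (hψ : ∀ k ∈ B, ψ k ∈ Ψ)
    (h1 : ∀ k ∈ B, ε < |∫ s, ψ k s ∂(μ k)|)
    (h2 : ∀ k ∈ B, ∑ i ∈ B with i < k, |∫ s, ψ k s ∂(μ i)| ^ q ≤ ε ^ q) : B.card ≤ d := by
  have hle : (B.card : ℕ∞) ≤ eluderDim q Ψ 𝓜 ε₀ := by
    refine le_iSup₂_of_le B.card ⟨fun t => μ (B.orderEmbOfFin rfl t), fun t =>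
      hμ _ (B.orderEmbOfFin_mem rfl t), ε, hε, fun t => ⟨ψ (B.orderEmbOfFin rfl t),
        hψ _ (B.orderEmbOfFin_mem rfl t), h1 _ (B.orderEmbOfFin_mem rfl t), ?_⟩⟩ le_rfl
    refine le_trans (le_of_eq ?_) (h2 _ (B.orderEmbOfFin_mem rfl t))
    refine Finset.sum_bij (fun i _ => B.orderEmbOfFin rfl i) (fun i hi => ?_)
      (fun i _ j _ hij => (B.orderEmbOfFin rfl).injective hij) (fun b hb => ?_) (fun _ _ => rfl)
    · rw [Finset.mem_filter]
      exact ⟨B.orderEmbOfFin_mem rfl i, (B.orderEmbOfFin rfl).lt_iff_lt.2 (Finset.mem_Iio.1 hi)⟩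
    · rw [Finset.mem_filter] at hb
      have : b ∈ Set.range (B.orderEmbOfFin rfl) := by
        rw [Finset.range_orderEmbOfFin]; exact hb.1
      obtain ⟨i, rfl⟩ := this
      exact ⟨i, Finset.mem_Iio.2 ((B.orderEmbOfFin rfl).lt_iff_lt.1 hb.2), rfl⟩
  exact_mod_cast hle.trans hd

/-- Elements whose influences on each later one have a small sum can be put into `N` buckets so
that the influences inside of each bucket are small. -/
theorem exists_bucket {K : ℕ} (a : Fin K → Fin K → ℝ) {ε : ℝ} {N : ℕ}
    (hN : 0 < N) (h : ∀ k, ∑ i ∈ Finset.Iio k, a i k ≤ N * ε) :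
    ∃ b : Fin K → Fin N, ∀ k, ∑ i ∈ Finset.Iio k with b i = b k, a i k ≤ ε := by
  -- Pigeonhole: if every bucket had influence above `ε` on `k`, the total would exceed `N * ε`. The
  -- elements are then placed greedily in increasing order.
  have hex : ∀ (k : Fin K) (b : Fin K → Fin N),
      ∃ j : Fin N, ∑ i ∈ Finset.Iio k with b i = j, a i k ≤ ε := by
    intro k b
    by_contra! hc
    have h1 := Finset.sum_fiberwise (Finset.Iio k) b (fun i => a i k)
    have : Nonempty (Fin N) := ⟨⟨0, hN⟩⟩
    have h2 : ∑ _j : Fin N, ε < ∑ j : Fin N, ∑ i ∈ Finset.Iio k with b i = j, a i k :=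
      Finset.sum_lt_sum_of_nonempty Finset.univ_nonempty fun j _ => hc j
    rw [h1] at h2
    simp only [Finset.sum_const, Finset.card_univ, Fintype.card_fin, nsmul_eq_mul] at h2
    exact absurd (h k) (not_le.2 h2)
  have key : ∀ m : ℕ, ∃ b : Fin K → Fin N, ∀ k : Fin K, (k : ℕ) < m →
      ∑ i ∈ Finset.Iio k with b i = b k, a i k ≤ ε := by
    intro m
    induction m with
    | zero => exact ⟨fun _ => ⟨0, hN⟩, fun k hk => absurd hk (Nat.not_lt_zero _)⟩
    | succ m ih =>
      obtain ⟨b, hb⟩ := ih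
      by_cases hm : m < K
      · obtain ⟨j, hj⟩ := hex ⟨m, hm⟩ b
        refine ⟨Function.update b ⟨m, hm⟩ j, fun k hk => ?_⟩
        have hne : ∀ i ∈ Finset.Iio k, Function.update b ⟨m, hm⟩ j i = b i := by
          intro i hi
          refine Function.update_of_ne (fun e => ?_) _ _
          have := Finset.mem_Iio.1 hi
          rw [e, Fin.lt_def] at this
          simp only at this
          omega
        rcases Nat.lt_succ_iff_lt_or_eq.1 hk with hk' | hk'
        · have hk2 : Function.update b ⟨m, hm⟩ j k = b k :=
            Function.update_of_ne (fun e => by rw [e] at hk'; exact lt_irrefl _ hk') _ _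
          rw [hk2, Finset.filter_congr fun i hi => by rw [hne i hi]]
          exact hb k hk'
        · obtain rfl : k = ⟨m, hm⟩ := Fin.ext hk'
          rw [Function.update_self, Finset.filter_congr fun i hi => by rw [hne i hi]]
          exact hj
      · exact ⟨b, fun k hk => hb k (by have := k.2; omega)⟩
  obtain ⟨b, hb⟩ := key K
  exact ⟨b, fun k => hb k k.2⟩

/-- The number of rounds with a large error, when the in-sample errors are bounded. -/
theorem card_large_le {S : Type*} [MeasurableSpace S] {Ψ : Set (S → ℝ)} {𝓜 : Set (Measure S)}
    {ε₀ ε : ℝ} {d : ℕ} (hd : eluderDim 2 Ψ 𝓜 ε₀ ≤ d) (hε : ε₀ ≤ ε) (hε0 : 0 < ε) {K : ℕ}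
    (μ : Fin K → Measure S) (hμ : ∀ k, μ k ∈ 𝓜) (ψ : Fin K → S → ℝ) (hψ : ∀ k, ψ k ∈ Ψ)
    (h0 : ∀ i k, 0 ≤ ∫ s, ψ k s ∂(μ i)) {R : ℝ} (hR0 : 0 ≤ R)
    (hR : ∀ k, ∑ i ∈ Finset.Iio k, ∫ s, ψ k s ∂(μ i) ≤ R) :
    ((Finset.univ.filter fun k => ε < ∫ s, ψ k s ∂(μ k)).card : ℝ) ≤ (R / ε + 1) * d := by
  set N := ⌊R / ε⌋₊ + 1 with hN
  have hNε : R ≤ N * ε := by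
    have := (Nat.lt_floor_add_one (R / ε)).le
    rw [div_le_iff₀ hε0] at this
    rw [hN]; push_cast; exact this
  obtain ⟨b, hb⟩ := exists_bucket (fun i k => ∫ s, ψ k s ∂(μ i)) (ε := ε) (N := N)
    (by omega) (fun k => (hR k).trans hNε)
  set B := Finset.univ.filter fun k => ε < ∫ s, ψ k s ∂(μ k) with hB
  have hcard : ∀ j ∈ (Finset.univ : Finset (Fin N)), (B.filter fun k => b k = j).card ≤ d := by
    intro j _
    refine card_le_of_eluderDim_le hd hε _ μ (fun k _ => hμ k) ψ (fun k _ => hψ k)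
      (fun k hk => ?_) (fun k hk => ?_)
    · rw [Finset.mem_filter, hB, Finset.mem_filter] at hk
      rw [abs_of_nonneg (h0 k k)]
      exact hk.1.2
    · rw [Finset.mem_filter] at hk
      have h1 : ∑ i ∈ (B.filter fun k => b k = j) with i < k, |∫ s, ψ k s ∂(μ i)| ≤ ε := by
        refine le_trans ?_ (hb k)
        simp_rw [abs_of_nonneg (h0 _ k)]
        refine Finset.sum_le_sum_of_subset_of_nonneg (fun i hi => ?_) fun i _ _ => h0 i k
        simp only [Finset.mem_filter, Finset.mem_Iio] at hi ⊢
        exact ⟨hi.2, hi.1.2.trans hk.2.symm⟩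
      -- The buckets control the sum of the errors themselves, which is stronger than the sum of
      -- squares in the definition. This is why the count scales like R/ε.
      refine (Finset.sum_sq_le_sq_sum_of_nonneg fun i _ => abs_nonneg _).trans ?_
      exact pow_le_pow_left₀ (Finset.sum_nonneg fun i _ => abs_nonneg _) h1 2
  have h2 : B.card ≤ N * d := by
    rw [Finset.card_eq_sum_card_fiberwise (f := b) (t := Finset.univ) fun _ _ => Finset.mem_univ _]
    refine (Finset.sum_le_sum hcard).trans ?_
    simp
  have h3 : (N : ℝ) ≤ R / ε + 1 := by
    rw [hN]; push_cast
    linarith [Nat.floor_le (div_nonneg hR0 hε0.le)]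
  calc (B.card : ℝ) ≤ N * d := by exact_mod_cast h2
    _ ≤ (R / ε + 1) * d := by gcongr

/-- Discrete layer cake. -/
theorem le_layers {K : ℕ} (hK : 0 < K) {e : ℝ} (he1 : e ≤ 1) :
    e ≤ 1 / K + ∑ j ∈ Finset.Ico 1 K, if (j : ℝ) / K < e then 1 / (K : ℝ) else 0 := by
  have hK' : (0 : ℝ) < K := by exact_mod_cast hK
  -- Either `e` also lies below the previous level, or all thresholds so far are exceeded and the
  -- sum has its full value.
  have key : ∀ n : ℕ, 1 ≤ n → n ≤ K → e ≤ n / K →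
      e ≤ 1 / K + ∑ j ∈ Finset.Ico 1 n, if (j : ℝ) / K < e then 1 / (K : ℝ) else 0 := by
    intro n hn
    induction n, hn using Nat.le_induction with
    | base => intro _ h; simpa using h
    | succ n hn ih =>
      intro hnK h
      rcases le_or_gt e (n / K) with h' | h'
      · refine (ih (by omega) h').trans ?_
        rw [Finset.sum_Ico_succ_top hn]
        have : (0 : ℝ) ≤ if (n : ℝ) / K < e then 1 / (K : ℝ) else 0 := by split_ifs <;> positivity
        linarith
      · have hall : ∀ j ∈ Finset.Ico 1 (n + 1),
            (if (j : ℝ) / K < e then 1 / (K : ℝ) else 0) = 1 / K := by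
          intro j hj
          rw [Finset.mem_Ico] at hj
          rw [if_pos]
          refine lt_of_le_of_lt ?_ h'
          have : (j : ℝ) ≤ n := by exact_mod_cast Nat.lt_succ_iff.1 hj.2
          gcongr
        rw [Finset.sum_congr rfl hall]
        refine h.trans (le_of_eq ?_)
        simp
        field_simp
        ring
  exact key K hK le_rfl (by rwa [div_self hK'.ne'])

theorem sum_inv_Ico_le (K : ℕ) :
    ∑ j ∈ Finset.Ico 1 K, (1 : ℝ) / j ≤ 1 + Real.log K := by
  have h := harmonic_le_one_add_log K
  rw [harmonic_eq_sum_Icc] at h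
  push_cast at h
  refine le_trans ?_ h
  simp_rw [one_div]
  exact Finset.sum_le_sum_of_subset_of_nonneg (fun j hj => by
    simp only [Finset.mem_Ico, Finset.mem_Icc] at *; omega) fun _ _ _ => by positivity

/-- The eluder bound for the sum of the errors. -/
theorem sum_integral_le_of_eluderDim_le {S : Type*} [MeasurableSpace S] {Ψ : Set (S → ℝ)}
    {𝓜 : Set (Measure S)} {d K : ℕ} (hK : 0 < K) (hd : eluderDim 2 Ψ 𝓜 (1 / K) ≤ d)
    (μ : Fin K → Measure S) (hμ : ∀ k, μ k ∈ 𝓜) (ψ : Fin K → S → ℝ) (hψ : ∀ k, ψ k ∈ Ψ)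
    (h0 : ∀ i k, 0 ≤ ∫ s, ψ k s ∂(μ i)) (h1 : ∀ k, ∫ s, ψ k s ∂(μ k) ≤ 1)
    {R : ℝ} (hR0 : 0 ≤ R) (hR : ∀ k, ∑ i ∈ Finset.Iio k, ∫ s, ψ k s ∂(μ i) ≤ R) :
    ∑ k, ∫ s, ψ k s ∂(μ k) ≤ 1 + d + d * R * (1 + Real.log K) := by
  have hK' : (0 : ℝ) < K := by exact_mod_cast hK
  calc ∑ k, ∫ s, ψ k s ∂(μ k)
      ≤ ∑ k, (1 / (K : ℝ) + ∑ j ∈ Finset.Ico 1 K,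
          if (j : ℝ) / K < ∫ s, ψ k s ∂(μ k) then 1 / (K : ℝ) else 0) :=
        Finset.sum_le_sum fun k _ => le_layers hK (h1 k)
    _ = 1 + ∑ j ∈ Finset.Ico 1 K, (Finset.univ.filter fun k : Fin K =>
          (j : ℝ) / K < ∫ s, ψ k s ∂(μ k)).card * (1 / (K : ℝ)) := by
        rw [Finset.sum_add_distrib, Finset.sum_comm]
        congr 1
        · simp [hK'.ne']
        · refine Finset.sum_congr rfl fun j _ => ?_
          rw [← Finset.sum_filter, Finset.sum_const, nsmul_eq_mul]
    _ ≤ 1 + ∑ j ∈ Finset.Ico 1 K, (d * R * (1 / j) + d * (1 / K)) := by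
        gcongr with j hj
        rw [Finset.mem_Ico] at hj
        have hj0 : (1 : ℝ) ≤ j := by exact_mod_cast hj.1
        have hj1 : (0 : ℝ) < j := by linarith
        -- Levels with j ≥ 1 are at least 1/K, the resolution of the eluder dimension.
        have := card_large_le hd (ε := j / K) (by gcongr) (by positivity) μ hμ ψ hψ h0 hR0 hR
        calc _ ≤ (R / (j / K) + 1) * d * (1 / (K : ℝ)) := by gcongr
          _ = d * R * (1 / j) + d * (1 / K) := by field_simp
    _ ≤ 1 + (d * R * (1 + Real.log K) + d) := by
        rw [Finset.sum_add_distrib, ← Finset.mul_sum]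
        gcongr
        · exact sum_inv_Ico_le K
        · rw [Finset.sum_const, Nat.card_Ico, nsmul_eq_mul]
          have : ((K - 1 : ℕ) : ℝ) ≤ K := by exact_mod_cast Nat.sub_le K 1
          calc ((K - 1 : ℕ) : ℝ) * (d * (1 / K)) ≤ K * (d * (1 / K)) := by gcongr
            _ = d := by field_simp
    _ = _ := by ring

end Eluder

/-! ### Bounds for minima over actions. -/

section MinAct

variable {X A : Type*} {H : ℕ}

theorem minAct_mem_Icc [Nonempty A] {g : X × A → ℝ} (hg : ∀ p, g p ∈ Set.Icc (0 : ℝ) 1) (x : X) :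
    minAct g x ∈ Set.Icc (0 : ℝ) 1 := by
  have hb : BddBelow (Set.range fun a => g (x, a)) :=
    ⟨0, by rintro _ ⟨a, rfl⟩; exact (hg _).1⟩
  exact ⟨le_ciInf fun a => (hg _).1,
    (ciInf_le hb (Classical.arbitrary A)).trans (hg _).2⟩

theorem minAct_le {g : X × A → ℝ} (hg : ∀ p, g p ∈ Set.Icc (0 : ℝ) 1) (p : X × A) :
    minAct g p.1 ≤ g p :=
  ciInf_le (f := fun a => g (p.1, a)) ⟨0, by rintro _ ⟨a, rfl⟩; exact (hg _).1⟩ p.2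

theorem minAct_zero [Nonempty A] (x : X) : minAct (0 : X × A → ℝ) x = 0 := by
  simp [minAct]

theorem next_mem_nextClass {F : Fin H → Finset (X × A → ℝ)} {f : Fin H → X × A → ℝ}
    (hf : f ∈ tuples F) (h : Fin H) : next f h ∈ nextClass F h := by
  unfold next nextClass
  split_ifs
  · exact hf _
  · rfl

end MinAct

/-! ### Value decomposition, optimism and the Bellman solution. -/

section Value

variable {X A : Type*} [MeasurableSpace X] [MeasurableSpace A] {H : ℕ}

instance isProbabilityMeasure_visit (M : MDP X A H) (π : Policy X A H) (h : Fin H) :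
    IsProbabilityMeasure (visit M π h) :=
  Measure.isProbabilityMeasure_map
    (by fun_prop : Measurable fun τ : RoundData X A H => (τ h).1).aemeasurable

instance isProbabilityMeasure_stateVisit (M : MDP X A H) (π : Policy X A H) (h : Fin H) :
    IsProbabilityMeasure (stateVisit M π h) :=
  Measure.isProbabilityMeasure_map
    (by fun_prop : Measurable fun τ : RoundData X A H => (τ h).1.1).aemeasurable

theorem visit_eq_compProd (M : MDP X A H) (π : Policy X A H) (h : Fin H) :
    visit M π h = stateVisit M π h ⊗ₘ π.act h :=
  map_rollIn_stateAction M π.act h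

theorem integral_stateVisit (M : MDP X A H) (π : Policy X A H) (h : Fin H) {v : X → ℝ}
    (hv : Measurable v) : ∫ x, v x ∂(stateVisit M π h) = ∫ p, v p.1 ∂(visit M π h) := by
  rw [stateVisit, visit, integral_map
    (by fun_prop : Measurable fun τ : RoundData X A H => (τ h).1.1).aemeasurable
    hv.aestronglyMeasurable, integral_map (f := fun p : X × A => v p.1)
    (by fun_prop : Measurable fun τ : RoundData X A H => (τ h).1).aemeasurable
    (hv.comp measurable_fst).aestronglyMeasurable]

theorem ae_cost_mem (M : MDP X A H) (π : Policy X A H) (h : Fin H) :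
    ∀ᵐ τ ∂(rollIn M π.act), (τ h).2.1 ∈ Set.Icc (0 : ℝ) 1 := by
  have hs : MeasurableSet {t : Transition X A | t.2.1 ∈ Set.Icc (0 : ℝ) 1} :=
    measurableSet_Icc.preimage (by fun_prop : Measurable fun t : Transition X A => t.2.1)
  refine (ae_map_iff (p := fun t : Transition X A => t.2.1 ∈ Set.Icc (0 : ℝ) 1)
    (measurable_pi_apply h : Measurable fun τ : RoundData X A H => τ h).aemeasurable hs).1 ?_
  change ∀ᵐ t ∂((rollIn M π.act).map (fun τ => τ h)), _
  rw [map_rollIn_transition, Measure.ae_compProd_iff hs]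
  refine Filter.Eventually.of_forall fun p => ?_
  rw [Kernel.prod_apply]
  exact Measure.quasiMeasurePreserving_fst.ae (M.cost_mem h p)

theorem integrable_cost (M : MDP X A H) (π : Policy X A H) (h : Fin H) :
    Integrable (fun τ : RoundData X A H => (τ h).2.1) (rollIn M π.act) :=
  Integrable.of_mem_Icc 0 1
    (by fun_prop : Measurable fun τ : RoundData X A H => (τ h).2.1).aemeasurable
    (ae_cost_mem M π h)

theorem integral_bellman_visit (M : MDP X A H) (π : Policy X A H) (h : Fin H) {g : X × A → ℝ}
    (hg : Measurable (minAct g)) (h01 : ∀ x, minAct g x ∈ Set.Icc (0 : ℝ) 1) :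
    ∫ p, bellman M h g p ∂(visit M π h) =
      ∫ τ, (τ h).2.1 ∂(rollIn M π.act) + ∫ τ, minAct g (τ h).2.2 ∂(rollIn M π.act) := by
  have hm : Measurable fun t : Transition X A => t.2.1 + minAct g t.2.2 :=
    (by fun_prop : Measurable fun t : Transition X A => t.2.1).add
      (hg.comp (by fun_prop : Measurable fun t : Transition X A => t.2.2))
  have hm' : Measurable fun τ : RoundData X A H => minAct g (τ h).2.2 :=
    hg.comp (by fun_prop : Measurable fun τ : RoundData X A H => (τ h).2.2)
  have hi' : Integrable (fun τ : RoundData X A H => minAct g (τ h).2.2) (rollIn M π.act) :=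
    Integrable.of_mem_Icc 0 1 hm'.aemeasurable (Filter.Eventually.of_forall fun τ => h01 _)
  have hi := (integrable_cost M π h).add hi'
  have hi2 : Integrable (fun t : Transition X A => t.2.1 + minAct g t.2.2)
      ((rollIn M π.act).map (fun τ => τ h)) :=
    (integrable_map_measure hm.aestronglyMeasurable (measurable_pi_apply h).aemeasurable).2 hi
  have e := integral_map (μ := rollIn M π.act) (measurable_pi_apply h).aemeasurable
    hm.aestronglyMeasurable
  rw [← integral_add (integrable_cost M π h) hi', ← e]
  rw [map_rollIn_transition] at hi2
  refine Eq.trans ?_ (congrArg (fun μ => ∫ t : Transition X A, t.2.1 + minAct g t.2.2 ∂μ)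
    (map_rollIn_transition M π.act h)).symm
  exact (Measure.integral_compProd hi2).symm

/-- The value of a policy in terms of the Bellman backups of `f`. -/
theorem value_sub_minAct [NeZero H] [Nonempty A] (M : MDP X A H) (π : Policy X A H)
    {f : Fin H → X × A → ℝ} (hm : ∀ h, Measurable (minAct (f h)))
    (h01 : ∀ h x, minAct (f h) x ∈ Set.Icc (0 : ℝ) 1) :
    value M π - minAct (f 0) M.init = ∑ h, (∫ p, bellman M h (next f h) p ∂(visit M π h) -
      ∫ x, minAct (f h) x ∂(stateVisit M π h)) := by
  -- Extending by 0 at index `H` encodes the terminal convention, so the telescoping sum needs no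
  -- separate last term.
  set m : ℕ → ℝ := fun i => if hi : i < H then
    ∫ x, minAct (f ⟨i, hi⟩) x ∂(stateVisit M π ⟨i, hi⟩) else 0 with hm_def
  have hH : 0 < H := Nat.pos_of_ne_zero (NeZero.ne H)
  have h0 : m 0 = minAct (f 0) M.init := by
    have e : (⟨0, hH⟩ : Fin H) = 0 := rfl
    simp only [hm_def, dif_pos hH, e]
    rw [stateVisit, map_rollIn_init, integral_dirac' _ _ (hm 0).stronglyMeasurable]
  have hlast : m H = 0 := by simp [hm_def]
  have hstep : ∀ h : Fin H, ∫ p, bellman M h (next f h) p ∂(visit M π h) =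
      ∫ τ, (τ h).2.1 ∂(rollIn M π.act) + m (h + 1) := by
    intro h
    by_cases hh : (h : ℕ) + 1 < H
    · have e : next f h = f ⟨h + 1, hh⟩ := by simp [next, hh]
      rw [e, integral_bellman_visit M π h (hm _) (h01 _)]
      simp only [hm_def, dif_pos hh]
      rw [stateVisit, map_rollIn_next M π.act h hh, integral_map
        (by fun_prop : Measurable fun τ : RoundData X A H => (τ ⟨h, _⟩).2.2).aemeasurable
        (hm _).aestronglyMeasurable]
    · have e : next f h = 0 := by simp [next, hh]
      have e0 : minAct (0 : X × A → ℝ) = fun _ => 0 := funext minAct_zero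
      rw [e, integral_bellman_visit M π h (by rw [e0]; exact measurable_const)
        (by simp [e0])]
      simp [hm_def, hh, e0]
  have hval : value M π = ∑ h, ∫ τ, (τ h).2.1 ∂(rollIn M π.act) := by
    rw [value, integral_finsetSum _ fun h _ => integrable_cost M π h]
  have hmh : ∀ h : Fin H, ∫ x, minAct (f h) x ∂(stateVisit M π h) = m h := by
    intro h
    simp [hm_def]
  have htel : ∑ h : Fin H, (m (h + 1) - m h) = m H - m 0 := by
    rw [Fin.sum_univ_eq_sum_range (fun i => m (i + 1) - m i) H, Finset.sum_range_sub]
  have e2 : ∑ h, (∫ p, bellman M h (next f h) p ∂(visit M π h) -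
      ∫ x, minAct (f h) x ∂(stateVisit M π h)) =
      ∑ h : Fin H, (∫ τ, (τ h).2.1 ∂(rollIn M π.act) + (m (h + 1) - m h)) := by
    refine Finset.sum_congr rfl fun h _ => ?_
    rw [hstep, hmh]
    ring
  rw [e2, Finset.sum_add_distrib, htel, hval, hlast, h0]
  ring

theorem integrable_of_mem {μ : Measure (X × A)} [IsProbabilityMeasure μ] {g : X × A → ℝ}
    (hg : Measurable g) (h01 : ∀ p, g p ∈ Set.Icc (0 : ℝ) 1) : Integrable g μ :=
  Integrable.of_mem_Icc 0 1 hg.aemeasurable (Filter.Eventually.of_forall h01)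

/-- A solution of the Bellman equations bounds the value of every policy from below. -/
theorem minAct_le_value [NeZero H] [Nonempty A] (M : MDP X A H) (π : Policy X A H)
    {q : Fin H → X × A → ℝ} (hq : ∀ h, Measurable (q h)) (hm : ∀ h, Measurable (minAct (q h)))
    (h01 : ∀ h p, q h p ∈ Set.Icc (0 : ℝ) 1) (hB : ∀ h, q h = bellman M h (next q h)) :
    minAct (q 0) M.init ≤ value M π := by
  rw [← sub_nonneg, value_sub_minAct M π hm fun h => minAct_mem_Icc (h01 h)]
  refine Finset.sum_nonneg fun h _ => sub_nonneg.2 ?_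
  rw [← hB h, integral_stateVisit M π h (hm h)]
  exact integral_mono (integrable_of_mem ((hm h).comp measurable_fst)
    fun p => minAct_mem_Icc (h01 h) p.1) (integrable_of_mem (hq h) (h01 h))
    fun p => minAct_le (h01 h) p

theorem integral_le_sqrt {S : Type*} [MeasurableSpace S] {μ : Measure S} [IsProbabilityMeasure μ]
    {u : S → ℝ} (hu : Measurable u) (h1 : ∀ s, |u s| ≤ 1) :
    ∫ s, u s ∂μ ≤ √(∫ s, u s ^ 2 ∂μ) := by
  have hL : MemLp u 2 μ := MemLp.of_bound hu.aestronglyMeasurable 1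
    (Filter.Eventually.of_forall h1)
  -- Jensen's inequality for the square, in the form of a nonnegative variance.
  have := variance_nonneg u μ
  rw [variance_eq_sub hL] at this
  refine Real.le_sqrt_of_sq_le ?_
  simpa using this

/-- The value of a greedy policy is close to the prediction of `f` if the squared Bellman errors
of `f` are small. -/
theorem value_sub_minAct_le [NeZero H] [Nonempty A] (M : MDP X A H) (π : Policy X A H)
    {f : Fin H → X × A → ℝ} (hf : ∀ h, Measurable (f h)) (hm : ∀ h, Measurable (minAct (f h)))
    (h01 : ∀ h p, f h p ∈ Set.Icc (0 : ℝ) 1) (hT : ∀ h, Measurable (bellman M h (next f h)))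
    (hT01 : ∀ h p, bellman M h (next f h) p ∈ Set.Icc (0 : ℝ) 1)
    (hπ : ∀ h x, ∀ᵐ a ∂(π.act h x), ∀ a', f h (x, a) ≤ f h (x, a')) :
    value M π - minAct (f 0) M.init ≤ ∑ h, √(∫ p, sqError M h f p ∂(visit M π h)) := by
  rw [value_sub_minAct M π hm fun h => minAct_mem_Icc (h01 h)]
  refine Finset.sum_le_sum fun h _ => ?_
  have e : ∫ x, minAct (f h) x ∂(stateVisit M π h) = ∫ p, f h p ∂(visit M π h) := by
    rw [integral_stateVisit M π h (hm h)]
    refine integral_congr_ae ?_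
    rw [visit_eq_compProd]
    refine (Measure.ae_compProd_iff
      (measurableSet_eq_fun ((hm h).comp measurable_fst) (hf h))).2 ?_
    -- Greediness enters here: the played action almost surely attains the infimum.
    refine Filter.Eventually.of_forall fun x => ?_
    filter_upwards [hπ h x] with a ha
    exact le_antisymm (minAct_le (h01 h) (x, a)) (le_ciInf ha)
  rw [e, ← integral_sub (integrable_of_mem (hT h) (hT01 h)) (integrable_of_mem (hf h) (h01 h))]
  have h2 := integral_le_sqrt (μ := visit M π h)
    (u := fun p => bellman M h (next f h) p - f h p) ((hT h).sub (hf h)) fun p => by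
      have h1 := hT01 h p
      have h2 := h01 h p
      rw [Set.mem_Icc] at h1 h2
      rw [abs_le]
      constructor <;> linarith
  refine h2.trans (le_of_eq ?_)
  congr 2
  funext p
  rw [sqError, sub_sq_comm]

/-- A Bellman complete class contains a solution of the Bellman equations. -/
theorem BellmanComplete.exists_solution {M : MDP X A H} {F : Fin H → Finset (X × A → ℝ)}
    (hB : BellmanComplete M F) : ∃ q ∈ tuples F, ∀ h, q h = bellman M h (next q h) := by
  -- Backward induction: the equations are solved on the last `m` steps, and completeness keeps each
  -- new backup in the class.
  have key : ∀ m ≤ H, ∃ q : Fin H → X × A → ℝ, ∀ h : Fin H, H ≤ h + m →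
      q h ∈ F h ∧ q h = bellman M h (next q h) := by
    intro m
    induction m with
    | zero => exact fun _ => ⟨fun _ => 0, fun h hh => by have := h.2; omega⟩
    | succ m ih =>
      intro hmH
      obtain ⟨q, hq⟩ := ih (by omega)
      set j : Fin H := ⟨H - (m + 1), by omega⟩ with hj
      set q' := Function.update q j (bellman M j (next q j)) with hq'
      have hnext : ∀ h : Fin H, j ≤ h → next q' h = next q h := by
        intro h hh
        rw [Fin.le_def] at hh
        unfold next
        split_ifs with hlt
        · refine Function.update_of_ne (fun e => ?_) _ _
          have := congrArg Fin.val e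
          simp only at this
          omega
        · rfl
      refine ⟨q', fun h hh => ?_⟩
      have hjh : j ≤ h := by rw [Fin.le_def]; simp only [hj]; omega
      rw [hnext h hjh]
      rcases eq_or_lt_of_le hjh with e | hlt
      · subst e
        have e : q' j = bellman M j (next q j) := Function.update_self _ _ _
        rw [e]
        refine ⟨hB j _ ?_, rfl⟩
        unfold nextClass next
        split_ifs with hlt
        · exact (hq _ (by simp only [hj]; omega)).1
        · rfl
      · have e : q' h = q h := Function.update_of_ne hlt.ne' _ _
        rw [e]
        rw [Fin.lt_def] at hlt
        exact hq h (by simp only [hj] at hlt; omega)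
  obtain ⟨q, hq⟩ := key H le_rfl
  exact ⟨q, fun h => (hq h (by omega)).1, fun h => (hq h (by omega)).2⟩

/-- Every probability measure on `A` has density at most `Nat.card A` with respect to the uniform
one. -/
theorem integral_le_card_mul_uniformOn [MeasurableSingletonClass A] [Finite A] [Nonempty A]
    (ν : Measure A) [IsProbabilityMeasure ν] {s : A → ℝ} (hs : ∀ a, 0 ≤ s a) :
    ∫ a, s a ∂ν ≤ Nat.card A * ∫ a, s a ∂(uniformOn (Set.univ : Set A)) := by
  have := Fintype.ofFinite A
  have : IsProbabilityMeasure (uniformOn (Set.univ : Set A)) :=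
    isProbabilityMeasure_uniformOn Set.finite_univ Set.univ_nonempty
  have hc : (Nat.card A : ℝ) ≠ 0 := by exact_mod_cast Nat.card_pos.ne'
  rw [integral_fintype Integrable.of_finite, integral_fintype Integrable.of_finite,
    Finset.mul_sum]
  refine Finset.sum_le_sum fun a _ => ?_
  have e : (uniformOn (Set.univ : Set A)).real {a} = (Nat.card A : ℝ)⁻¹ := by
    rw [Measure.real, uniformOn_univ, Measure.count_singleton]
    simp
  rw [e, smul_eq_mul, smul_eq_mul, ← mul_assoc, mul_inv_cancel₀ hc]
  gcongr
  · exact hs a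
  · exact measureReal_le_one

end Value

/-! ### Regret bound on the good event. -/

section Main

theorem sum_castLE_eq {K : ℕ} (k : Fin K) (φ : Fin K → ℝ) :
    ∑ i : Fin k, φ (Fin.castLE k.2.le i) = ∑ i ∈ Finset.Iio k, φ i := by
  refine Finset.sum_bij (fun i _ => Fin.castLE k.2.le i) (fun i _ => ?_)
    (fun i _ j _ hij => Fin.castLE_injective _ hij) (fun b hb => ?_) (fun _ _ => rfl)
  · rw [Finset.mem_Iio, Fin.lt_def]; exact i.2
  · exact ⟨⟨b, Fin.lt_def.1 (Finset.mem_Iio.1 hb)⟩, Finset.mem_univ _, rfl⟩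

variable {X A : Type*} [MeasurableSpace X] [MeasurableSpace A] [MeasurableSingletonClass A]
  [Nonempty A] {H : ℕ}

/-- The eluder bound for the Bellman errors under the played policies. -/
theorem sum_visit_sqError_le (M : MDP X A H) {F : Fin H → Finset (X × A → ℝ)} (ua : Bool)
    (hua : ua = true → Finite A) {K d : ℕ} (hK : 0 < K)
    (hd : (d : ℕ∞) = if ua then (Nat.card A : ℕ∞) * max 1 (dSqV M F K) else max 1 (dSq M F K))
    (f : Fin K → Fin H → X × A → ℝ) (hf : ∀ k, f k ∈ tuples F) (π : Fin K → Policy X A H)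
    (h : Fin H) (hm : ∀ k, Measurable (sqError M h (f k))) (h1 : ∀ k p, sqError M h (f k) p ≤ 1)
    {R : ℝ} (hR0 : 0 ≤ R)
    (hR : ∀ k, ∑ i ∈ Finset.Iio k, ∫ p, sqError M h (f k) p ∂(explored M ua (π i) h) ≤ R) :
    ∑ k, ∫ p, sqError M h (f k) p ∂(visit M (π k) h) ≤ d * (2 + R * (1 + Real.log K)) := by
  have h0 : ∀ k p, 0 ≤ sqError M h (f k) p := fun k p => sq_nonneg _
  have hlog : 0 ≤ Real.log K := Real.log_natCast_nonneg K
  have fin : ∀ D : ℕ, 1 ≤ D → 1 + D + D * R * (1 + Real.log K) ≤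
      D * (2 + R * (1 + Real.log K)) := by
    intro D hD
    have : (1 : ℝ) ≤ D := by exact_mod_cast hD
    nlinarith
  have int1 : ∀ (μ : Measure (X × A)) [IsProbabilityMeasure μ] k,
      ∫ p, sqError M h (f k) p ∂μ ≤ 1 := by
    intro μ _ k
    refine (integral_mono (integrable_of_mem (hm k) fun p => ⟨h0 k p, h1 k p⟩)
      (integrable_const 1) (h1 k)).trans ?_
    simp
  cases ua with
  | false =>
    simp only [Bool.false_eq_true, if_false] at hd
    have hd1 : 1 ≤ d := by
      have : (1 : ℕ∞) ≤ d := hd ▸ le_max_left _ _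
      exact_mod_cast this
    have hd2 : eluderDim 2 (sqError M h '' tuples F) (Set.range fun π => visit M π h) (1 / K) ≤ d :=
      hd ▸ (le_iSup (fun h => eluderDim 2 (sqError M h '' tuples F)
        (Set.range fun π => visit M π h) (1 / K)) h).trans (le_max_right _ _)
    refine (sum_integral_le_of_eluderDim_le hK hd2 (fun k => visit M (π k) h)
      (fun k => ⟨π k, rfl⟩) (fun k => sqError M h (f k)) (fun k => ⟨f k, hf k, rfl⟩)
      (fun i k => integral_nonneg (h0 k)) (fun k => int1 _ k) hR0 hR).trans (fin d hd1)
  | true =>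
    have := hua rfl
    have := isMarkovKernel_uniformAct (X := X) (A := A)
    have hU : IsProbabilityMeasure (uniformOn (Set.univ : Set A)) :=
      isProbabilityMeasure_uniformOn Set.finite_univ Set.univ_nonempty
    simp only [if_true] at hd
    have hc : (Nat.card A : ℕ∞) ≠ 0 := by exact_mod_cast Nat.card_pos.ne'
    -- The product with a nonzero cardinality is the natural number `d`, so the eluder factor is
    -- finite.
    obtain ⟨D, hD⟩ : ∃ D : ℕ, (D : ℕ∞) = max 1 (dSqV M F K) := by
      refine ENat.ne_top_iff_exists.1 fun htop => ?_
      rw [htop, ENat.mul_top hc] at hd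
      exact ENat.natCast_ne_top d hd
    rw [← hD] at hd
    have hdD : d = Nat.card A * D := by exact_mod_cast hd
    have hD1 : 1 ≤ D := by
      have : (1 : ℕ∞) ≤ D := hD ▸ le_max_left _ _
      exact_mod_cast this
    have hD2 : eluderDim 2 ((fun f x => ∫ a, sqError M h f (x, a) ∂(uniformOn (Set.univ : Set A))) ''
        tuples F) (Set.range fun π => stateVisit M π h) (1 / K) ≤ D :=
      hD ▸ (le_iSup (fun h => eluderDim 2 ((fun f x =>
        ∫ a, sqError M h f (x, a) ∂(uniformOn (Set.univ : Set A))) '' tuples F)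
        (Set.range fun π => stateVisit M π h) (1 / K)) h).trans (le_max_right _ _)
    have e : ∀ i k, ∫ p, sqError M h (f k) p ∂(explored M true (π i) h) =
        ∫ x, ∫ a, sqError M h (f k) (x, a) ∂(uniformOn (Set.univ : Set A))
          ∂(stateVisit M (π i) h) := by
      intro i k
      simp only [explored, if_true]
      rw [Measure.integral_compProd (integrable_of_mem (hm k) fun p => ⟨h0 k p, h1 k p⟩)]
      rfl
    have hV := sum_integral_le_of_eluderDim_le hK hD2 (fun k => stateVisit M (π k) h)
      (fun k => ⟨π k, rfl⟩)
      (fun k x => ∫ a, sqError M h (f k) (x, a) ∂(uniformOn (Set.univ : Set A)))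
      (fun k => ⟨f k, hf k, rfl⟩)
      (fun i k => integral_nonneg fun x => integral_nonneg fun a => h0 k (x, a))
      (fun k => by
        rw [← e]
        have := isProbabilityMeasure_explored M true hua (π k) h
        exact int1 _ k) hR0 (fun k => by simpa only [e] using hR k)
    have hle : ∀ k, ∫ p, sqError M h (f k) p ∂(visit M (π k) h) ≤ Nat.card A *
        ∫ x, ∫ a, sqError M h (f k) (x, a) ∂(uniformOn (Set.univ : Set A))
          ∂(stateVisit M (π k) h) := by
      intro k
      have hi : Integrable (sqError M h (f k)) (stateVisit M (π k) h ⊗ₘ (π k).act h) :=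
        integrable_of_mem (hm k) fun p => ⟨h0 k p, h1 k p⟩
      have hi' : Integrable (sqError M h (f k)) (stateVisit M (π k) h ⊗ₘ uniformAct X A) :=
        integrable_of_mem (hm k) fun p => ⟨h0 k p, h1 k p⟩
      rw [visit_eq_compProd, Measure.integral_compProd hi, ← integral_const_mul]
      have hj := ((Measure.integrable_compProd_iff hi.aestronglyMeasurable).1 hi).2
      have hj' := ((Measure.integrable_compProd_iff hi'.aestronglyMeasurable).1 hi').2
      simp only [Real.norm_of_nonneg (h0 k _)] at hj hj'
      exact integral_mono hj (hj'.const_mul _)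
        fun x => integral_le_card_mul_uniformOn _ fun a => h0 k (x, a)
    calc ∑ k, ∫ p, sqError M h (f k) p ∂(visit M (π k) h)
        ≤ Nat.card A * (D * (2 + R * (1 + Real.log K))) := by
          refine (Finset.sum_le_sum fun k _ => hle k).trans ?_
          rw [← Finset.mul_sum]
          exact mul_le_mul_of_nonneg_left (hV.trans (fin D hD1)) (Nat.cast_nonneg _)
      _ = d * (2 + R * (1 + Real.log K)) := by rw [hdD]; push_cast; ring

/-- The regret bound on the event that optimism and the in-sample error bounds hold. -/
theorem regret_le [NeZero H] (M : MDP X A H) {F : Fin H → Finset (X × A → ℝ)}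
    (hF : ∀ h, ∀ g ∈ F h, Measurable g) (hFm : ∀ h, ∀ g ∈ F h, Measurable (minAct g))
    (hF01 : ∀ h, ∀ g ∈ F h, ∀ p, g p ∈ Set.Icc (0 : ℝ) 1) (hB : BellmanComplete M F)
    (ua : Bool) (hua : ua = true → Finite A) {β : ℝ} (hβ0 : 0 ≤ β) {K : ℕ} (hK : 0 < K)
    {f : (k : ℕ) → History X A H k → Fin H → X × A → ℝ}
    {π : (k : ℕ) → Fin H → Kernel (History X A H k × X) A} [∀ k h, IsMarkovKernel (π k h)]
    (hopt : IsOptimistic M F β K f π) {d : ℕ}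
    (hd : (d : ℕ∞) = if ua then (Nat.card A : ℕ∞) * max 1 (dSqV M F K) else max 1 (dSq M F K))
    {q : Fin H → X × A → ℝ} (hq : q ∈ tuples F) (hqB : ∀ h, q h = bellman M h (next q h))
    (hβ : 1 ≤ β ∨ ∀ f ∈ tuples F, f = q) (D : History X A H K)
    (hD1 : ∀ k : Fin K, q ∈ versionSpace F β (past D k))
    (hD2 : ∀ (h : Fin H) (k : Fin K), ∑ i ∈ Finset.Iio k, ∫ p, sqError M h (f k (past D k)) p
      ∂(explored M ua (policyAt (π i) (past D i)) h) ≤ 20 * β) :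
    regret M π D ≤ 5 * H * √(K * d * β * (1 + Real.log K)) := by
  have hlog : 0 ≤ Real.log K := Real.log_natCast_nonneg K
  set g : Fin K → Fin H → X × A → ℝ := fun k => f k (past D k) with hg
  have hgF : ∀ k, g k ∈ tuples F := fun k => (hopt.mem k k.2 (past D k)).1
  have hT : ∀ k h, bellman M h (next (g k) h) ∈ F h := fun k h =>
    hB h _ (next_mem_nextClass (hgF k) h)
  have hmeas : ∀ k h, Measurable (sqError M h (g k)) := fun k h =>
    ((hF h _ (hgF k h)).sub (hF h _ (hT k h))).pow_const 2
  have hle1 : ∀ k h p, sqError M h (g k) p ≤ 1 := fun k h p => by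
    have h1 := hF01 h _ (hgF k h) p
    have h2 := hF01 h _ (hT k h) p
    rw [Set.mem_Icc] at h1 h2
    rw [sqError, sq_le_one_iff_abs_le_one, abs_le]
    constructor <;> linarith
  set e : Fin K → Fin H → ℝ := fun k h =>
    ∫ p, sqError M h (g k) p ∂(visit M (policyAt (π k) (past D k)) h) with he
  have he0 : ∀ k h, 0 ≤ e k h := fun k h => integral_nonneg fun p => sq_nonneg _
  have hsum : ∀ h, ∑ k, e k h ≤ 25 * (d * β * (1 + Real.log K)) := by
    intro h
    rcases hβ with hβ | hβ
    · refine (sum_visit_sqError_le M ua hua hK hd g hgF _ h (fun k => hmeas k h)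
        (fun k => hle1 k h) (by positivity) (hD2 h)).trans ?_
      have hd0 : (0 : ℝ) ≤ d := Nat.cast_nonneg d
      -- β ≥ 1 absorbs the additive 2; 25 is chosen as a perfect square.
      have h1 : 2 + 20 * β * (1 + Real.log K) ≤ 25 * (β * (1 + Real.log K)) := by nlinarith
      calc (d : ℝ) * (2 + 20 * β * (1 + Real.log K)) ≤ d * (25 * (β * (1 + Real.log K))) := by
            gcongr
        _ = _ := by ring
    · have hz : ∀ k, e k h = 0 := by
        intro k
        have : sqError M h (g k) = fun _ => 0 := by
          funext p
          rw [sqError, hβ _ (hgF k), ← hqB h]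
          ring
        simp [he, this]
      simp only [hz, Finset.sum_const_zero]
      positivity
  have hround : ∀ k : Fin K, value M (policyAt (π k) (past D k)) - optValue M ≤ ∑ h, √(e k h) := by
    intro k
    have h1 := value_sub_minAct_le M (policyAt (π k) (past D k)) (f := g k)
      (fun h => hF h _ (hgF k h)) (fun h => hFm h _ (hgF k h)) (fun h => hF01 h _ (hgF k h))
      (fun h => hF h _ (hT k h)) (fun h => hF01 h _ (hT k h))
      (fun h x => hopt.greedy k k.2 (past D k) h x)
    have h2 : minAct (g k 0) M.init ≤ optValue M := by
      have : Nonempty (Policy X A H) := ⟨policyAt (π k) (past D k)⟩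
      refine (hopt.optimistic k k.2 (past D k) q (hD1 k)).trans (le_ciInf fun π' => ?_)
      exact minAct_le_value M π' (fun h => hF h _ (hq h)) (fun h => hFm h _ (hq h))
        (fun h => hF01 h _ (hq h)) hqB
    linarith
  have hsqrt : ∀ h, ∑ k, √(e k h) ≤ 5 * √(K * d * β * (1 + Real.log K)) := by
    intro h
    have h1 : (∑ k, √(e k h)) ^ 2 ≤ K * ∑ k, e k h := by
      refine (sq_sum_le_card_mul_sum_sq (s := Finset.univ) (f := fun k => √(e k h))).trans ?_
      simp [Real.sq_sqrt (he0 _ h)]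
    refine (Real.le_sqrt_of_sq_le h1).trans ?_
    calc √(K * ∑ k, e k h) ≤ √(5 ^ 2 * (K * d * β * (1 + Real.log K))) := by
          refine Real.sqrt_le_sqrt ?_
          calc (K : ℝ) * ∑ k, e k h ≤ K * (25 * (d * β * (1 + Real.log K))) := by
                gcongr; exact hsum h
            _ = _ := by ring
      _ = _ := by rw [Real.sqrt_mul (by norm_num), Real.sqrt_sq (by norm_num)]
  calc regret M π D ≤ ∑ k, ∑ h, √(e k h) := Finset.sum_le_sum fun k _ => hround k
    _ = ∑ h, ∑ k, √(e k h) := Finset.sum_comm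
    _ ≤ ∑ _h : Fin H, 5 * √(K * d * β * (1 + Real.log K)) := Finset.sum_le_sum fun h _ => hsqrt h
    _ = 5 * H * √(K * d * β * (1 + Real.log K)) := by
        rw [Finset.sum_const, Finset.card_univ, Fintype.card_fin, nsmul_eq_mul]; ring

end Main

/-! ### Regularity of the next-step class. -/

section NextClass

variable {X A : Type*} [Nonempty A] {H : ℕ}

theorem minAct_mem_Icc_of_mem_nextClass {F : Fin H → Finset (X × A → ℝ)}
    (hF01 : ∀ h, ∀ g ∈ F h, ∀ p, g p ∈ Set.Icc (0 : ℝ) 1) {h : Fin H} {g : X × A → ℝ}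
    (hg : g ∈ nextClass F h) (x : X) : minAct g x ∈ Set.Icc (0 : ℝ) 1 := by
  unfold nextClass at hg
  split_ifs at hg with hh
  · exact minAct_mem_Icc (hF01 _ g hg) x
  · rw [Set.mem_singleton_iff.1 hg, minAct_zero]; simp

theorem measurable_minAct_of_mem_nextClass [MeasurableSpace X] {F : Fin H → Finset (X × A → ℝ)}
    (hFm : ∀ h, ∀ g ∈ F h, Measurable (minAct g)) {h : Fin H} {g : X × A → ℝ}
    (hg : g ∈ nextClass F h) : Measurable (minAct g) := by
  unfold nextClass at hg
  split_ifs at hg with hh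
  · exact hFm _ g hg
  · rw [Set.mem_singleton_iff.1 hg, funext minAct_zero]; exact measurable_const

end NextClass

/-! ### Probability of the good event. -/

section Event

variable {X A : Type*} [MeasurableSpace X] [MeasurableSpace A] [MeasurableSingletonClass A]
  [Nonempty A] {H : ℕ}

/-- The good event fails with probability at most `δ`. -/
theorem historyLaw_good [NeZero H] (M : MDP X A H) {F : Fin H → Finset (X × A → ℝ)}
    (hF : ∀ h, ∀ g ∈ F h, Measurable g) (hFm : ∀ h, ∀ g ∈ F h, Measurable (minAct g))
    (hF01 : ∀ h, ∀ g ∈ F h, ∀ p, g p ∈ Set.Icc (0 : ℝ) 1) (hB : BellmanComplete M F)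
    (ua : Bool) (hua : ua = true → Finite A) {δ : ℝ} (hδ : δ ∈ Set.Ioo (0 : ℝ) 1)
    {β : ℝ} (hβ : β = 2 * Real.log (H * (∏ h, (F h).card : ℕ) / δ)) (hβ0 : 0 ≤ β) (K : ℕ)
    (π : (k : ℕ) → Fin H → Kernel (History X A H k × X) A) [∀ k h, IsMarkovKernel (π k h)]
    {q : Fin H → X × A → ℝ} (hq : q ∈ tuples F) (hqB : ∀ h, q h = bellman M h (next q h)) :
    historyLaw M ua π K {D | ¬ ((∀ k : Fin K, q ∈ versionSpace F β (past D k)) ∧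
      ∀ k : Fin K, ∀ f ∈ versionSpace F β (past D k), ∀ h, ∑ i ∈ Finset.Iio k,
        ∫ p, sqError M h f p ∂(explored M ua (policyAt (π i) (past D i)) h) ≤ 20 * β)} ≤
      ENNReal.ofReal δ := by
  classical
  have hcard : ∀ h, 1 ≤ (F h).card := fun h => Finset.card_pos.2 ⟨q h, hq h⟩
  obtain ⟨N, hN⟩ : ∃ N : ℕ, N = ∏ h, (F h).card := ⟨_, rfl⟩
  rw [← hN] at hβ
  have hN1 : 1 ≤ N := hN ▸ Finset.one_le_prod' fun h _ => hcard h
  have hH1 : 1 ≤ H := Nat.one_le_iff_ne_zero.2 (NeZero.ne H)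
  have hHr : (0 : ℝ) < H := by exact_mod_cast hH1
  have hNr : (0 : ℝ) < N := by exact_mod_cast hN1
  set b : ℝ := β / 2 with hb
  have hexpb : Real.exp (-b) = δ / (H * N) := by
    have h1 : b = Real.log (H * N / δ) := by rw [hb, hβ, mul_div_cancel_left₀ _ two_ne_zero]
    have h2 : 0 < H * N / δ := div_pos (mul_pos hHr hNr) hδ.1
    rw [h1, Real.exp_neg, Real.exp_log h2, inv_div]
  have hexpβ : Real.exp (-β) = (δ / (H * N)) ^ 2 := by
    
    have h1 : -β = -b + -b := by rw [hb]; ring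
    rw [h1, Real.exp_add, hexpb, sq]
  have hTF : ∀ f ∈ tuples F, ∀ h, bellman M h (next f h) ∈ F h := fun f hf h =>
    hB h _ (next_mem_nextClass hf h)
  set B₁ : Fin H → (X × A → ℝ) → Set (History X A H K) := fun h g => {D | ∃ (k : ℕ) (hk : k ≤ K),
    b ≤ ∑ i : Fin k, -(1 / 2) * excessLoss M h g (next q h) (D (Fin.castLE hk i) h)} with hB₁
  set B₂ : Fin H → (Fin H → X × A → ℝ) → Set (History X A H K) := fun h f =>
    {D | ∃ (k : ℕ) (hk : k ≤ K), β ≤ ∑ i : Fin k,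
      (-(1 / 4) * excessLoss M h (f h) (next f h) (D (Fin.castLE hk i) h) +
        1 / 16 * ∫ p, (f h p - bellman M h (next f h) p) ^ 2 ∂(explored M ua (policyAt (π i)
          (fun j => D (Fin.castLE (i.2.le.trans hk) j))) h))} with hB₂
  -- The competitor `q h` itself is omitted, since its excess is zero. The probability saved pays
  -- for the second family of events.
  have hP₁ : ∀ h, ∀ g ∈ (F h).erase (q h),
      historyLaw M ua π K (B₁ h g) ≤ ENNReal.ofReal (δ / (H * N)) := by
    intro h g hg
    have hn := next_mem_nextClass hq h
    rw [← hexpb]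
    exact historyLaw_excessLoss M ua hua π h (hF h g (Finset.mem_of_mem_erase hg))
      (measurable_minAct_of_mem_nextClass hFm hn) (minAct_mem_Icc_of_mem_nextClass hF01 hn)
      (hF h _ (hTF q hq h)) b K
  -- The threshold here is β = 2b, so the failure probability is squared and survives a union over
  -- all `N` tuples.
  have hP₂ : ∀ h, ∀ f ∈ Fintype.piFinset F,
      historyLaw M ua π K (B₂ h f) ≤ ENNReal.ofReal ((δ / (H * N)) ^ 2) := by
    intro h f hf
    have hf' : f ∈ tuples F := Fintype.mem_piFinset.1 hf
    have hn := next_mem_nextClass hf' h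
    rw [← hexpβ]
    refine historyLaw_explored M ua hua π h (hF h _ (hf' h))
      (measurable_minAct_of_mem_nextClass hFm hn) (minAct_mem_Icc_of_mem_nextClass hF01 hn)
      (hF h _ (hTF f hf' h)) (fun p => ?_) β K
    have h1 := hF01 h _ (hf' h) p
    have h2 := hF01 h _ (hTF f hf' h) p
    rw [Set.mem_Icc] at h1 h2
    rw [sq_le_one_iff_abs_le_one, abs_le]
    constructor <;> linarith
  -- The bound covers all members of the version space, since the chosen `f` may depend on the data
  -- in any way.
  have hsub : {D | ¬ ((∀ k : Fin K, q ∈ versionSpace F β (past D k)) ∧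
      ∀ k : Fin K, ∀ f ∈ versionSpace F β (past D k), ∀ h, ∑ i ∈ Finset.Iio k,
        ∫ p, sqError M h f p ∂(explored M ua (policyAt (π i) (past D i)) h) ≤ 20 * β)} ⊆
      (⋃ h, ⋃ g ∈ (F h).erase (q h), B₁ h g) ∪ ⋃ h, ⋃ f ∈ Fintype.piFinset F, B₂ h f := by
    intro D hD
    by_contra hnot
    simp only [Set.mem_union, Set.mem_iUnion, not_or, not_exists] at hnot
    refine hD ⟨fun k => ⟨hq, fun h => ?_⟩, fun k f hf h => ?_⟩
    · have : Nonempty (F h) := ⟨⟨q h, hq h⟩⟩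
      rw [sub_le_iff_le_add, ← sub_le_iff_le_add']
      refine le_ciInf fun g => ?_
      by_cases hgq : (g : X × A → ℝ) = q h
      · rw [hgq]; linarith
      · have h1 := hnot.1 h g (Finset.mem_erase.2 ⟨hgq, g.2⟩)
        simp only [hB₁, Set.mem_ofPred_eq, not_exists, not_le] at h1
        have h2 := h1 k k.2.le
        have h3 := tdLoss_sub_tdLoss_bellman M h g (next q h) (past D k)
        rw [← hqB h] at h3
        rw [← Finset.mul_sum] at h2
        have h4 : ∑ i, excessLoss M h g (next q h) (past D k i h) =
          ∑ i : Fin k, excessLoss M h g (next q h) (D (Fin.castLE k.2.le i) h) := rfl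
        rw [← h4, ← h3] at h2
        linarith
    · have h1 := hnot.2 h f (Fintype.mem_piFinset.2 hf.1)
      simp only [hB₂, Set.mem_ofPred_eq, not_exists, not_le] at h1
      have h2 := h1 k k.2.le
      rw [Finset.sum_add_distrib, ← Finset.mul_sum, ← Finset.mul_sum] at h2
      have h3 := tdLoss_sub_tdLoss_bellman M h (f h) (next f h) (past D k)
      have h4 : ∑ i, excessLoss M h (f h) (next f h) (past D k i h) =
        ∑ i : Fin k, excessLoss M h (f h) (next f h) (D (Fin.castLE k.2.le i) h) := rfl
      have h5 : ∑ i : Fin k, ∫ p, (f h p - bellman M h (next f h) p) ^ 2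
          ∂(explored M ua (policyAt (π i)
            (fun j => D (Fin.castLE (i.2.le.trans k.2.le) j))) h) =
          ∑ i ∈ Finset.Iio k,
            ∫ p, sqError M h f p ∂(explored M ua (policyAt (π i) (past D i)) h) :=
        sum_castLE_eq k fun i =>
          ∫ p, sqError M h f p ∂(explored M ua (policyAt (π i) (past D i)) h)
      rw [h5, ← h4, ← h3] at h2
      have h6 := hf.2 h
      have h7 : (⨅ g : F h, tdLoss (past D k) h g (next f h)) ≤
          tdLoss (past D k) h (bellman M h (next f h)) (next f h) :=
        ciInf_le (f := fun g : F h => tdLoss (past D k) h g (next f h))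
          (Set.finite_range _).bddBelow ⟨_, hTF f hf.1 h⟩
      -- The excess of `f` is at most β, so the error sum is below 16(β + β/4) = 20β.
      linarith
  refine (measure_mono hsub).trans ((measure_union_le _ _).trans ?_)
  have hU₁ : historyLaw M ua π K (⋃ h, ⋃ g ∈ (F h).erase (q h), B₁ h g) ≤
      ENNReal.ofReal (H * ((N - 1) * (δ / (H * N)))) := by
    calc _ ≤ ∑ h, ∑ _g ∈ (F h).erase (q h), ENNReal.ofReal (δ / (H * N)) :=
          (measure_iUnion_fintype_le _ _).trans (Finset.sum_le_sum fun h _ =>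
            (measure_biUnion_finset_le _ _).trans (Finset.sum_le_sum (hP₁ h)))
      _ ≤ ∑ _h : Fin H, ENNReal.ofReal ((N - 1) * (δ / (H * N))) := by
          refine Finset.sum_le_sum fun h _ => ?_
          have hle : (((F h).erase (q h)).card : ℝ) ≤ N - 1 := by
            rw [Finset.card_erase_of_mem (hq h), Nat.cast_sub (hcard h), Nat.cast_one]
            have : (F h).card ≤ N := hN ▸ Finset.single_le_prod' (f := fun h => (F h).card)
              (fun h _ => hcard h) (Finset.mem_univ h)
            have : ((F h).card : ℝ) ≤ N := by exact_mod_cast this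
            linarith
          rw [Finset.sum_const, ← ENNReal.ofReal_nsmul, nsmul_eq_mul]
          have := hδ.1
          gcongr
      _ = _ := by
          rw [Finset.sum_const, Finset.card_univ, Fintype.card_fin, ← ENNReal.ofReal_nsmul,
            nsmul_eq_mul]
  have hU₂ : historyLaw M ua π K (⋃ h, ⋃ f ∈ Fintype.piFinset F, B₂ h f) ≤
      ENNReal.ofReal (H * (N * (δ / (H * N)) ^ 2)) := by
    calc _ ≤ ∑ _h : Fin H, ∑ _f ∈ Fintype.piFinset F, ENNReal.ofReal ((δ / (H * N)) ^ 2) :=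
          (measure_iUnion_fintype_le _ _).trans (Finset.sum_le_sum fun h _ =>
            (measure_biUnion_finset_le _ _).trans (Finset.sum_le_sum (hP₂ h)))
      _ = _ := by
          rw [Finset.sum_const, Finset.sum_const, Fintype.card_piFinset, ← hN, Finset.card_univ,
            Fintype.card_fin, ← ENNReal.ofReal_nsmul, ← ENNReal.ofReal_nsmul, nsmul_eq_mul,
            nsmul_eq_mul]
  have hN1' : (1 : ℝ) ≤ N := by exact_mod_cast hN1
  have hH1' : (1 : ℝ) ≤ H := by exact_mod_cast hH1
  refine (add_le_add hU₁ hU₂).trans ?_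
  have hδ0 := hδ.1
  have hδ1 := hδ.2
  rw [← ENNReal.ofReal_add (mul_nonneg hHr.le (mul_nonneg (by linarith) (by positivity)))
    (by positivity)]
  refine ENNReal.ofReal_le_ofReal ?_
  have e : H * ((N - 1) * (δ / (H * N))) + H * (N * (δ / (H * N)) ^ 2) =
      δ - δ / N * (1 - δ / H) := by
    field_simp
    ring
  rw [e]
  have h1 : δ / H ≤ 1 := by rw [div_le_one hHr]; linarith
  have h2 : 0 ≤ δ / N * (1 - δ / H) := mul_nonneg (by positivity) (by linarith)
  linarith

end Event

end OnlineRL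

/-! ### Assembly of the theorem. -/

open OnlineRL
theorem mainTheorem6 :
    ∃ c : ℝ, 0 < c ∧
      ∀ (X A : Type*) [MeasurableSpace X] [MeasurableSpace A] [MeasurableSingletonClass A]
        [Nonempty A] (H : ℕ) [NeZero H] (M : MDP X A H)
        (F : Fin H → Finset (X × A → ℝ))
        (_ : ∀ h, ∀ g ∈ F h, Measurable g)
        (_ : ∀ h, ∀ g ∈ F h, Measurable (minAct g))
        (_ : ∀ h, ∀ g ∈ F h, ∀ p, g p ∈ Set.Icc (0 : ℝ) 1)
        (_ : BellmanComplete M F)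
        (ua : Bool) (_ : ua = true → Finite A)
        (δ : ℝ) (_ : δ ∈ Set.Ioo (0 : ℝ) 1)
        (β : ℝ) (_ : β = 2 * Real.log (H * (∏ h, (F h).card : ℕ) / δ))
        (K : ℕ) (_ : 0 < K)
        (f : (k : ℕ) → History X A H k → Fin H → X × A → ℝ)
        (π : (k : ℕ) → Fin H → Kernel (History X A H k × X) A)
        [∀ k h, IsMarkovKernel (π k h)]
        (_ : IsOptimistic M F β K f π)
        (d : ℕ)
        (_ : (d : ℕ∞) = if ua then (Nat.card A : ℕ∞) * max 1 (dSqV M F K) else max 1 (dSq M F K)),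
        ENNReal.ofReal (1 - δ) ≤ historyLaw M ua π K
          {D | regret M π D ≤ c * H * √(K * d * β * (1 + Real.log K))} := by
  refine ⟨5, by norm_num, ?_⟩
  intro X A _ _ _ _ H _ M F hF hFm hF01 hB ua hua δ hδ β hβ K hK f π _ hopt d hd
  obtain ⟨q, hq, hqB⟩ := hB.exists_solution
  have hcard : ∀ h, 1 ≤ (F h).card := fun h => Finset.card_pos.2 ⟨q h, hq h⟩
  have hN1 : 1 ≤ ∏ h, (F h).card := Finset.one_le_prod' fun h _ => hcard h
  have hH1 : 1 ≤ H := Nat.one_le_iff_ne_zero.2 (NeZero.ne H)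
  have hHN : (1 : ℝ) ≤ H * (∏ h, (F h).card : ℕ) := by exact_mod_cast Nat.mul_le_mul hH1 hN1
  have hlt : (H * (∏ h, (F h).card : ℕ) : ℝ) ≤ H * (∏ h, (F h).card : ℕ) / δ := by
    rw [le_div_iff₀ hδ.1]
    nlinarith [hδ.2]
  have hβ0 : 0 ≤ β := by
    rw [hβ]
    exact mul_nonneg (by norm_num) (Real.log_nonneg (hHN.trans hlt))
  -- With at least two tuples, β ≥ 2 ln 2 > 1. With a single tuple β may be close to 0, but then all
  -- Bellman errors vanish.
  have hβ1 : 1 ≤ β ∨ ∀ f ∈ tuples F, f = q := by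
    rcases Nat.lt_or_ge 1 (∏ h, (F h).card) with h2 | h2
    · left
      have h3 : (2 : ℝ) ≤ H * (∏ h, (F h).card : ℕ) := by exact_mod_cast Nat.mul_le_mul hH1 h2
      have h4 := Real.log_le_log (by norm_num) (h3.trans hlt)
      rw [hβ]
      linarith [Real.log_two_gt_d9]
    · right
      intro f hf
      have h3 : (Fintype.piFinset F).card ≤ 1 := by rwa [Fintype.card_piFinset]
      exact Finset.card_le_one.1 h3 f (Fintype.mem_piFinset.2 hf) q (Fintype.mem_piFinset.2 hq)
  have hgood := historyLaw_good M hF hFm hF01 hB ua hua hδ hβ hβ0 K π hq hqB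
  have hbad : historyLaw M ua π K
      {D | regret M π D ≤ 5 * H * √(K * d * β * (1 + Real.log K))}ᶜ ≤ ENNReal.ofReal δ := by
    refine (measure_mono fun D hD => ?_).trans hgood
    refine fun hG => hD (regret_le M hF hFm hF01 hB ua hua hβ0 hK hopt hd hq hqB hβ1 D hG.1 ?_)
    exact fun h k => hG.2 k _ (hopt.mem k k.2 (past D k)) h
  have hprob := isProbabilityMeasure_historyLaw M ua hua π K
  -- Subadditivity suffices here, so measurability of the regret event is not needed.
  have hone : (1 : ℝ≥0∞) ≤ historyLaw M ua π K
      {D | regret M π D ≤ 5 * H * √(K * d * β * (1 + Real.log K))} + ENNReal.ofReal δ := by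
    rw [← measure_univ (μ := historyLaw M ua π K), ← Set.union_compl_self
      {D | regret M π D ≤ 5 * H * √(K * d * β * (1 + Real.log K))}]
    exact (measure_union_le _ _).trans (by gcongr)
  rw [ENNReal.ofReal_sub _ hδ.1.le, ENNReal.ofReal_one]
  exact tsub_le_iff_right.2 hone
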